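/- Let $\mathbb K\in\{\mathbb R,\mathbb C\}$ and $p\in[1,\infty]$. For $n\ge 1$ let $\ell_p^n$ denote $\mathbb K^n$ with the $\ell_p$-norm. For normed spaces $E,F$ over $\mathbb K$ let $d_{BM}(E,F)=\inf\|T\|\,\|T^{-1}\|$ be their Banach–Mazur distance, the infimum being over all linear isomorphisms $T\colon E\to F$ that are bounded with bounded inverse ($d_{BM}(E,F)=\infty$ if there is none). A Banach space $Y$ over $\mathbb K$ is said to contain the $\ell_p^n$'s uniformly if there are $\lambda\in[1,\infty)$ and a sequence $(E_n)_{n\ge1}$ of linear subspaces of $Y$ such that $d_{BM}(E_n,\ell_p^n)\le\lambda$ for every $n\ge1$. Let $L_p=L_p(\Omega,\nu;\mathbb K)$ for an arbitrary measure space $(\Omega,\nu)$, let $Y$ be a Banach space over $\mathbb K$ that contains the $\ell_p^n$'s uniformly, and let $M\subseteq L_p$ be a subset that, with the metric induced by $\|\cdot\|_p$, is a proper metric space, that is, all closed balls of $M$ are compact. Then for every real $r<\frac1{16}$ and every continuous, non-decreasing, surjective function $\mu\colon(0,\infty)\to(-\infty,0)$ there exists a map $f\colon M\to Y$ such that for all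 $x,y\in M$ $$2^{\mu(\|x-y\|_p)}\,r\,\|x-y\|_p\le\|f(x)-f(y)\|_Y\le 9\,\|x-y\|_p,$$ where the left-hand side is read as $0$ if $x=y$. -/

import Mathlib

open MeasureTheory
open scoped ENNReal

/-- The Banach–Mazur distance `inf ‖T‖ ‖T⁻¹‖`, the infimum being over all linear isomorphisms
`T : E → F` (bounded with bounded inverse). It is `∞` if `E` and `F` are not isomorphic. -/
noncomputable def banachMazurDist (𝕜 : Type*) [RCLike 𝕜] (E F : Type*)
    [NormedAddCommGroup E] [NormedSpace 𝕜 E] [NormedAddCommGroup F] [NormedSpace 𝕜 F] : ℝ≥0∞ :=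
  ⨅ T : E ≃L[𝕜] F, ENNReal.ofReal (‖(T : E →L[𝕜] F)‖ * ‖(T.symm : F →L[𝕜] E)‖)

/-- `Y` contains the spaces `ℓ_p^n` `lam`-uniformly: there is a sequence of subspaces `E n` of `Y`
with `E n` at Banach–Mazur distance at most `lam` from `ℓ_p^n`, for every `n ≥ 1`. -/
def ContainsEllpLamUniformly (𝕜 : Type*) [RCLike 𝕜] (p : ℝ≥0∞) [Fact (1 ≤ p)] (lam : ℝ)
    (Y : Type*) [NormedAddCommGroup Y] [NormedSpace 𝕜 Y] : Prop :=
  ∃ E : ℕ → Submodule 𝕜 Y, ∀ n : ℕ, 1 ≤ n →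
    banachMazurDist 𝕜 (E n) (PiLp p (fun _ : Fin n => 𝕜)) ≤ ENNReal.ofReal lam

/-- `Y` contains the spaces `ℓ_p^n` uniformly. -/
def ContainsEllpUniformly (𝕜 : Type*) [RCLike 𝕜] (p : ℝ≥0∞) [Fact (1 ≤ p)]
    (Y : Type*) [NormedAddCommGroup Y] [NormedSpace 𝕜 Y] : Prop :=
  ∃ lam : ℝ, 1 ≤ lam ∧ ContainsEllpLamUniformly 𝕜 p lam Y

/-!
The proof has two independent halves.

*Copies of `ℓ_p^n` with an absolute constant.* The constants in the conclusion do not depend on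
the constant `λ` with which `Y` contains the `ℓ_p^n`'s, so `λ` has to be replaced by an absolute
constant first (`ContainsEllpUniformly.hasCopies`, with constant `10`). For `p = ∞` this is a
finite version of James' non-distortion argument (`HasCopies.improve_top`). For `p < ∞` it is a
weak form of Krivine's theorem. Iterated limits along ultrafilters produce a norm on words
(finite sequences of scalars) which is finitely representable in `Y`, equivalent to the `ℓ_p`-norm
and unchanged when zeros are inserted (`SpreadingNorm`). Replacing every letter `c` by a multiple
`c u_K` of a word and letting `K → ∞` improves the norm: the words `1, ζ, ζ², …` are shifted by a
multiplication by `ζ`, which makes the norm invariant under multiplication of letters by `ζ`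
(used for `-1` and `I`, this gives a lattice norm up to a factor), and the self-similar words
`w_{K+1} = 1 (a w_K) (a w_K)` with `|a| = 2 ^ (-1/p)` make it possible to split a letter `c` in
two letters `a c`. Every word is then comparable with a constant word with very small letters,
whose length is determined by the `ℓ_p`-norm (`SpreadingNorm.bounds_of_split`).

*The embedding.* Copies of `ℓ_p^n` exist in all finite-codimensional subspaces, because long
blocks of coordinates meet these. Hence countably many of them, of prescribed dimensions, can be
put in `Y` with coordinate projections of norm at most `2.2` (`HasCopies.exists_decomposition`).
Compact subsets of `L_p` are mapped to `ℓ_p^n` by `1`-Lipschitz maps which distort distances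
above a given scale very little (`exists_lipschitz_approx`). For each `n` and `k` such a map,
accurate on the ball of radius `exp (32 (n + 1))` of `M` above the scale `σ k` with
`μ (σ k) = -(k + 2)`, is put in a block of its own with the weight `2 ^ (-(k + 1))` times a weight
concentrated on the shell where `log ‖x - t₀‖` is about `32 n` (`exists_glued_map`). The shells
overlap so slowly that the change of the weights contributes only `1/8` of the Lipschitz constant.
For the lower bound it is enough to look at one block: `k` is chosen with
`-(k + 1) ≤ μ ‖x - y‖ < -k`, and `n` such that the shell has weight at least `1/2` at the point
which is farther from `t₀`.
-/

open Filter Topology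

/-! ### Powers of `ℓ_p`-norms of words -/

/-- The sum `∑ ‖c‖ ^ P` over the letters `c` of a word, that is, the `P`-th power of the
`ℓ_P`-norm of the word. -/
noncomputable def powSum {𝕜 : Type*} [RCLike 𝕜] (P : ℝ) (l : List 𝕜) : ℝ :=
  (l.map fun c => ‖c‖ ^ P).sum

/-- The vector `∑ lᵢ yᵢ` with coefficients the letters of the word `l`. -/
def wordComb {𝕜 : Type*} [RCLike 𝕜] {Y : Type*} [AddCommGroup Y] [Module 𝕜 Y] :
    (ℕ → Y) → List 𝕜 → Y
  | _, [] => 0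
  | y, c :: l => c • y 0 + wordComb (fun i => y (i + 1)) l

section PowSum

variable {𝕜 : Type*} [RCLike 𝕜] {P : ℝ}

@[simp] theorem powSum_nil : powSum P ([] : List 𝕜) = 0 := by simp [powSum]

@[simp] theorem powSum_cons (c : 𝕜) (l : List 𝕜) :
    powSum P (c :: l) = ‖c‖ ^ P + powSum P l := by simp [powSum]

@[simp] theorem powSum_append (l l' : List 𝕜) :
    powSum P (l ++ l') = powSum P l + powSum P l' := by simp [powSum]

theorem powSum_nonneg (l : List 𝕜) : 0 ≤ powSum P l := by
  induction l with
  | nil => simp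
  | cons c l ih => rw [powSum_cons]; positivity

theorem powSum_map_mul (c : 𝕜) (l : List 𝕜) :
    powSum P (l.map (c * ·)) = ‖c‖ ^ P * powSum P l := by
  induction l with
  | nil => simp
  | cons d l ih =>
    simp only [List.map_cons, powSum_cons, ih, norm_mul]
    rw [Real.mul_rpow (norm_nonneg _) (norm_nonneg _)]; ring

end PowSum

/-- The word obtained from `l` by replacing each letter `c` by the word `c u`. -/
def substWord {𝕜 : Type*} [RCLike 𝕜] (u l : List 𝕜) : List 𝕜 :=
  l.flatMap fun c => u.map (c * ·)

section Subst

variable {𝕜 : Type*} [RCLike 𝕜] {P : ℝ} (u : List 𝕜)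

@[simp] theorem substWord_nil : substWord u [] = [] := rfl

@[simp] theorem substWord_cons (c : 𝕜) (l : List 𝕜) :
    substWord u (c :: l) = u.map (c * ·) ++ substWord u l := by simp [substWord]

@[simp] theorem substWord_append (l l' : List 𝕜) :
    substWord u (l ++ l') = substWord u l ++ substWord u l' := by simp [substWord]

theorem powSum_substWord (l : List 𝕜) :
    powSum P (substWord u l) = powSum P l * powSum P u := by
  induction l with
  | nil => simp
  | cons c l ih => simp [powSum_map_mul, ih, add_mul]

theorem length_substWord (l : List 𝕜) : (substWord u l).length = l.length * u.length := by
  induction l with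
  | nil => simp
  | cons c l ih => simp [ih, add_mul, add_comm]

theorem substWord_map_mul (c : 𝕜) (l : List 𝕜) :
    substWord u (l.map (c * ·)) = (substWord u l).map (c * ·) := by
  induction l with
  | nil => simp
  | cons d l ih => simp [ih, mul_assoc]

theorem zipWith_add_map_mul (c d : 𝕜) :
    List.zipWith (· + ·) (u.map (c * ·)) (u.map (d * ·)) = u.map ((c + d) * ·) := by
  induction u with
  | nil => simp
  | cons e u ih => simp [ih, add_mul]

theorem substWord_zipWith_add (l l' : List 𝕜) (h : l.length = l'.length) :
    substWord u (List.zipWith (· + ·) l l') =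
      List.zipWith (· + ·) (substWord u l) (substWord u l') := by
  induction l generalizing l' with
  | nil => simp
  | cons c l ih =>
    cases l' with
    | nil => simp at h
    | cons c' l' =>
      have h' : l.length = l'.length := by simpa using h
      simp only [List.zipWith_cons_cons, substWord_cons, ih l' h']
      rw [List.zipWith_append (by simp), zipWith_add_map_mul]

end Subst

section WordComb

variable {𝕜 : Type*} [RCLike 𝕜] {Y : Type*} [AddCommGroup Y] [Module 𝕜 Y]

@[simp] theorem wordComb_nil (y : ℕ → Y) : wordComb y ([] : List 𝕜) = 0 := rfl

@[simp] theorem wordComb_cons (y : ℕ → Y) (c : 𝕜) (l : List 𝕜) :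
    wordComb y (c :: l) = c • y 0 + wordComb (fun i => y (i + 1)) l := rfl

theorem wordComb_append (y : ℕ → Y) (l l' : List 𝕜) :
    wordComb y (l ++ l') = wordComb y l + wordComb (fun i => y (i + l.length)) l' := by
  induction l generalizing y with
  | nil => simp
  | cons c l ih => simp [ih, add_assoc]

theorem wordComb_map_mul (y : ℕ → Y) (c : 𝕜) (l : List 𝕜) :
    wordComb y (l.map (c * ·)) = c • wordComb y l := by
  induction l generalizing y with
  | nil => simp
  | cons d l ih => simp [ih, mul_smul]

theorem wordComb_smul (y : ℕ → Y) (c : 𝕜) (l : List 𝕜) :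
    wordComb (fun i => c • y i) l = c • wordComb y l := by
  induction l generalizing y with
  | nil => simp
  | cons d l ih => rw [wordComb_cons, wordComb_cons, ih, smul_add, smul_comm]

theorem wordComb_substWord (u : List 𝕜) (y : ℕ → Y) (l : List 𝕜) :
    wordComb y (substWord u l) =
      wordComb (fun i => wordComb (fun j => y (i * u.length + j)) u) l := by
  induction l generalizing y with
  | nil => simp
  | cons c l ih =>
    simp only [substWord_cons, wordComb_append, wordComb_map_mul, wordComb_cons, ih,
      List.length_map]
    congr 2
    · simp
    · funext i
      congr 1
      funext j
      congr 1
      ring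

theorem map_wordComb {E : Type*} [AddCommGroup E] [Module 𝕜 E] (f : E →ₗ[𝕜] Y) (y : ℕ → E)
    (l : List 𝕜) : f (wordComb y l) = wordComb (fun i => f (y i)) l := by
  induction l generalizing y with
  | nil => simp
  | cons c l ih => simp [ih]

theorem wordComb_ofFn (y : ℕ → Y) (n : ℕ) (a : Fin n → 𝕜) :
    wordComb y (List.ofFn a) = ∑ i, a i • y i := by
  induction n generalizing y with
  | zero => simp
  | succ n ih => rw [List.ofFn_succ, wordComb_cons, ih, Fin.sum_univ_succ]; simp

end WordComb

/-! ### Spreading norms on words equivalent to the `ℓ_p`-norm -/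

/-- `G` is a seminorm on words, equivalent with constant `C` to the `ℓ_P`-norm, unchanged when
the letter `0` is inserted anywhere in a word (so that it does not see the position of the
letters, only their order), and finitely representable in `Y`. -/
structure SpreadingNorm {𝕜 : Type*} [RCLike 𝕜] (Y : Type*) [NormedAddCommGroup Y]
    [NormedSpace 𝕜 Y] (P C : ℝ) (G : List 𝕜 → ℝ) : Prop where
  add_le : ∀ l l' : List 𝕜, l.length = l'.length →
    G (List.zipWith (· + ·) l l') ≤ G l + G l'
  map_mul : ∀ (c : 𝕜) (l : List 𝕜), G (l.map (c * ·)) = ‖c‖ * G l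
  insert_zero : ∀ A B : List 𝕜, G (A ++ 0 :: B) = G (A ++ B)
  lower : ∀ l, powSum P l ^ (1 / P) ≤ G l
  upper : ∀ l, G l ≤ C * powSum P l ^ (1 / P)
  rep : ∀ F : Finset (List 𝕜), ∀ ε > 0, ∃ y : ℕ → Y, ∀ l ∈ F, |‖wordComb y l‖ - G l| < ε

namespace SpreadingNorm

variable {𝕜 : Type*} [RCLike 𝕜] {Y : Type*} [NormedAddCommGroup Y] [NormedSpace 𝕜 Y]
  {P C : ℝ} {G : List 𝕜 → ℝ}

theorem nonneg (hG : SpreadingNorm Y P C G) (l : List 𝕜) : 0 ≤ G l :=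
  (Real.rpow_nonneg (powSum_nonneg l) _).trans (hG.lower l)

theorem insert_replicate_zero (hG : SpreadingNorm Y P C G) (A B : List 𝕜) (n : ℕ) :
    G (A ++ (List.replicate n 0 ++ B)) = G (A ++ B) := by
  induction n with
  | zero => simp
  | succ n ih => rw [List.replicate_succ, List.cons_append, hG.insert_zero, ih]

/-- The norm of a word depends only on its non-zero letters. -/
theorem append_eq_of_filter_eq (hG : SpreadingNorm Y P C G) {l l' : List 𝕜} (A B : List 𝕜)
    (h : l.filter (fun c => decide (c ≠ 0)) = l'.filter (fun c => decide (c ≠ 0))) :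
    G (A ++ (l ++ B)) = G (A ++ (l' ++ B)) := by
  have key : ∀ (l A : List 𝕜),
      G (A ++ (l ++ B)) = G (A ++ (l.filter (fun c => decide (c ≠ 0)) ++ B)) := by
    intro l
    induction l with
    | nil => intro A; simp
    | cons c l ih =>
      intro A
      by_cases hc : c = 0
      · subst hc
        rw [List.cons_append, hG.insert_zero, ih A]
        simp
      · have := ih (A ++ [c])
        simpa [hc] using this
  rw [key l, key l', h]

theorem append_zipWith_le (hG : SpreadingNorm Y P C G) (A B : List 𝕜) {v z : List 𝕜}
    (h : v.length = z.length) :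
    G (A ++ (List.zipWith (· + ·) v z ++ B)) ≤ G (A ++ (v ++ B)) + G z := by
  have h1 := hG.add_le (A ++ (v ++ B))
    (List.replicate A.length 0 ++ (z ++ List.replicate B.length 0)) (by simp [h])
  have h0 : ∀ D : List 𝕜, List.zipWith (· + ·) D (List.replicate D.length 0) = D := by
    intro D
    induction D with
    | nil => simp
    | cons d D ih => simp [List.replicate_succ, ih]
  rw [List.zipWith_append (by simp), List.zipWith_append h, h0, h0] at h1
  have h2 := hG.insert_replicate_zero [] (z ++ List.replicate B.length 0) A.length
  have h3 := hG.insert_replicate_zero z [] B.length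
  simp only [List.nil_append, List.append_nil] at h2 h3
  rw [h2, h3] at h1
  exact h1

theorem abs_append_zipWith_sub_le (hG : SpreadingNorm Y P C G) (A B : List 𝕜) {v z : List 𝕜}
    (h : v.length = z.length) :
    |G (A ++ (List.zipWith (· + ·) v z ++ B)) - G (A ++ (v ++ B))| ≤ G z := by
  rw [abs_le]
  have h1 := hG.append_zipWith_le A B h
  have h2 := hG.append_zipWith_le A B (v := List.zipWith (· + ·) v z) (z := z.map ((-1) * ·))
    (by simp [h])
  have h3 : List.zipWith (· + ·) (List.zipWith (· + ·) v z) (z.map ((-1) * ·)) = v := by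
    clear h1 h2
    induction v generalizing z with
    | nil => simp
    | cons d D ih =>
      cases z with
      | nil => simp at h
      | cons e z =>
        have := ih (z := z) (by simpa using h)
        simpa using this
  rw [h3, hG.map_mul] at h2
  simp only [norm_neg, norm_one, one_mul] at h2
  constructor <;> linarith

theorem apply_singleton_le (hG : SpreadingNorm Y P C G) (hP : 1 ≤ P) (c : 𝕜) :
    G [c] ≤ C * ‖c‖ := by
  have h := hG.upper [c]
  rwa [powSum_cons, powSum_nil, add_zero, ← Real.rpow_mul (norm_nonneg _),
    mul_one_div_cancel (by linarith), Real.rpow_one] at h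

/-- Deleting one letter changes the norm at most by a multiple of the size of the letter. -/
theorem abs_delete_le (hG : SpreadingNorm Y P C G) (hP : 1 ≤ P) (A B : List 𝕜) (c : 𝕜) :
    |G (A ++ c :: B) - G (A ++ B)| ≤ C * ‖c‖ := by
  have h := hG.abs_append_zipWith_sub_le A B (v := [0]) (z := [c]) rfl
  simp only [List.zipWith_cons_cons, List.zipWith_nil_left, zero_add, List.cons_append,
    List.nil_append, hG.insert_zero] at h
  exact h.trans (hG.apply_singleton_le hP c)

/-- Substituting a fixed word `u`, normalised, for the letters preserves all the properties of a
spreading norm, with the same constant. -/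
theorem subst (hG : SpreadingNorm Y P C G) {u : List 𝕜} (hu : 0 < powSum P u) :
    SpreadingNorm Y P C fun l => G (substWord u l) / powSum P u ^ (1 / P) := by
  have hpos : 0 < powSum P u ^ (1 / P) := Real.rpow_pos_of_pos hu _
  have hmul : ∀ l, powSum P (substWord u l) ^ (1 / P) =
      powSum P l ^ (1 / P) * powSum P u ^ (1 / P) := fun l => by
    rw [powSum_substWord, Real.mul_rpow (powSum_nonneg _) (powSum_nonneg _)]
  refine ⟨fun l l' h => ?_, fun c l => ?_, fun A B => ?_, fun l => ?_, fun l => ?_,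
    fun F ε hε => ?_⟩
  · rw [substWord_zipWith_add u l l' h, ← add_div]
    gcongr
    exact hG.add_le _ _ (by simp [length_substWord, h])
  · simp only [substWord_map_mul, hG.map_mul]; ring
  · have := hG.insert_replicate_zero (substWord u A) (substWord u B) u.length
    have h0 : u.map ((0 : 𝕜) * ·) = List.replicate u.length 0 := by simp
    simp only [substWord_append, substWord_cons, h0, this]
  · rw [le_div_iff₀ hpos, ← hmul]; exact hG.lower _
  · rw [div_le_iff₀ hpos, mul_assoc, ← hmul]; exact hG.upper _
  · classical
    obtain ⟨y, hy⟩ := hG.rep (F.image (substWord u)) (ε * powSum P u ^ (1 / P)) (by positivity)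
    set s := powSum P u ^ (1 / P) with hs
    refine ⟨fun i => ((s⁻¹ : ℝ) : 𝕜) • wordComb (fun j => y (i * u.length + j)) u,
      fun l hl => ?_⟩
    have h1 := hy _ (Finset.mem_image_of_mem _ hl)
    rw [wordComb_smul, ← wordComb_substWord, norm_smul, RCLike.norm_ofReal,
      abs_of_pos (inv_pos.2 hpos)]
    rw [show s⁻¹ * ‖wordComb y (substWord u l)‖ - G (substWord u l) / s =
      s⁻¹ * (‖wordComb y (substWord u l)‖ - G (substWord u l)) by ring, abs_mul,
      abs_of_pos (inv_pos.2 hpos), inv_mul_lt_iff₀ hpos, mul_comm]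
    exact h1

/-- A pointwise limit of spreading norms with the same constants is a spreading norm. -/
theorem of_tendsto {ι : Type*} {U : Filter ι} [U.NeBot] {H : ι → List 𝕜 → ℝ}
    (hH : ∀ i, SpreadingNorm Y P C (H i)) (hlim : ∀ l, Tendsto (fun i => H i l) U (𝓝 (G l))) :
    SpreadingNorm Y P C G := by
  refine ⟨fun l l' h => ?_, fun c l => ?_, fun A B => ?_, fun l => ?_, fun l => ?_,
    fun F ε hε => ?_⟩
  · exact le_of_tendsto_of_tendsto' (hlim _) ((hlim _).add (hlim _))
      fun i => (hH i).add_le l l' h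
  · refine tendsto_nhds_unique (hlim _) (((hlim l).const_mul ‖c‖).congr fun i => ?_)
    rw [(hH i).map_mul]
  · refine tendsto_nhds_unique (hlim _) ((hlim (A ++ B)).congr fun i => ?_)
    rw [(hH i).insert_zero]
  · exact ge_of_tendsto' (hlim l) fun i => (hH i).lower l
  · exact le_of_tendsto' (hlim l) fun i => (hH i).upper l
  · have h1 : ∀ᶠ i in U, ∀ l ∈ F, |H i l - G l| < ε / 2 := by
      rw [Finset.eventually_all]
      intro l _
      have := Metric.tendsto_nhds.1 (hlim l) (ε / 2) (by positivity)
      simpa [Real.dist_eq] using this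
    obtain ⟨i, hi⟩ := h1.exists
    obtain ⟨y, hy⟩ := (hH i).rep F (ε / 2) (by positivity)
    refine ⟨y, fun l hl => ?_⟩
    have := abs_sub_le (‖wordComb y l‖) (H i l) (G l)
    linarith [hi l hl, hy l hl]

end SpreadingNorm

/-- A bounded real function converges along any ultrafilter. -/
theorem Ultrafilter.exists_tendsto_of_bounded {ι : Type*} (U : Ultrafilter ι) {f : ι → ℝ}
    {a b : ℝ} (h : ∀ᶠ i in (U : Filter ι), f i ∈ Set.Icc a b) :
    ∃ L, Tendsto f U (𝓝 L) := by
  obtain ⟨L, -, hL⟩ := (isCompact_Icc (a := a) (b := b)).ultrafilter_le_nhds (U.map f)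
    (le_principal_iff.2 h)
  exact ⟨L, hL⟩

/-! ### Existence of a spreading norm -/

/-- The iterated limit `lim_{n₁} ⋯ lim_{n_k} N (v + a₁ e_{n₁} + ⋯ + a_k e_{n_k})` along a
non-principal ultrafilter, where `a₁, …, a_k` are the letters of the word. -/
noncomputable def iterLim {𝕜 : Type*} [RCLike 𝕜] (N : (ℕ →₀ 𝕜) → ℝ) :
    List 𝕜 → (ℕ →₀ 𝕜) → ℝ
  | [], v => N v
  | a :: l, v => limUnder (hyperfilter ℕ : Filter ℕ)
      fun n => iterLim N l (v + Finsupp.single n a)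

section IterLim

variable {𝕜 : Type*} [RCLike 𝕜] {P C : ℝ} {N : (ℕ →₀ 𝕜) → ℝ}

theorem eventually_hyperfilter_notMem (s : Finset ℕ) :
    ∀ᶠ n in (hyperfilter ℕ : Filter ℕ), n ∉ s :=
  hyperfilter_le_cofinite s.eventually_cofinite_notMem

theorem sum_rpow_add_single (hP : 1 ≤ P) (v : ℕ →₀ 𝕜) (a : 𝕜) {n : ℕ} (hn : n ∉ v.support) :
    (v + Finsupp.single n a).sum (fun _ c => ‖c‖ ^ P) =
      v.sum (fun _ c => ‖c‖ ^ P) + ‖a‖ ^ P := by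
  have h0 : ‖(0 : 𝕜)‖ ^ P = 0 := by rw [norm_zero, Real.zero_rpow (by linarith)]
  classical
  rw [add_comm v, ← Finsupp.single_add_erase n (Finsupp.single n a + v)]
  have hv : v n = 0 := Finsupp.notMem_support_iff.1 hn
  have he : (Finsupp.single n a + v).erase n = v := by
    ext i
    by_cases hi : i = n
    · subst hi; simp [hv]
    · simp [hi]
  rw [he]
  rw [Finsupp.sum_add_index_of_disjoint]
  · rw [Finsupp.sum_single_index h0]; simp [hv, add_comm]
  · rw [Finset.disjoint_left]
    intro i hi hi'
    have := Finsupp.support_single_subset hi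
    simp at this
    exact hn (this ▸ hi')

variable (hN : ∀ v, N v ∈ Set.Icc ((v.sum fun _ c => ‖c‖ ^ P) ^ (1 / P))
    (C * (v.sum fun _ c => ‖c‖ ^ P) ^ (1 / P)))
include hN

theorem iterLim_spec (hP : 1 ≤ P) (l : List 𝕜) :
    (∀ v, iterLim N l v ∈ Set.Icc (((v.sum fun _ c => ‖c‖ ^ P) + powSum P l) ^ (1 / P))
      (C * ((v.sum fun _ c => ‖c‖ ^ P) + powSum P l) ^ (1 / P))) ∧
    ∀ a v, Tendsto (fun n => iterLim N l (v + Finsupp.single n a)) (hyperfilter ℕ : Filter ℕ)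
      (𝓝 (iterLim N (a :: l) v)) := by
  have step : ∀ l : List 𝕜,
      (∀ v, iterLim N l v ∈ Set.Icc (((v.sum fun _ c => ‖c‖ ^ P) + powSum P l) ^ (1 / P))
      (C * ((v.sum fun _ c => ‖c‖ ^ P) + powSum P l) ^ (1 / P))) → ∀ a v,
      (∀ᶠ n in (hyperfilter ℕ : Filter ℕ), iterLim N l (v + Finsupp.single n a) ∈
        Set.Icc (((v.sum fun _ c => ‖c‖ ^ P) + powSum P (a :: l)) ^ (1 / P))
          (C * ((v.sum fun _ c => ‖c‖ ^ P) + powSum P (a :: l)) ^ (1 / P))) ∧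
      Tendsto (fun n => iterLim N l (v + Finsupp.single n a)) (hyperfilter ℕ : Filter ℕ)
        (𝓝 (iterLim N (a :: l) v)) := by
    intro l hl a v
    have h1 : ∀ᶠ n in (hyperfilter ℕ : Filter ℕ), iterLim N l (v + Finsupp.single n a) ∈
        Set.Icc (((v.sum fun _ c => ‖c‖ ^ P) + powSum P (a :: l)) ^ (1 / P))
          (C * ((v.sum fun _ c => ‖c‖ ^ P) + powSum P (a :: l)) ^ (1 / P)) := by
      filter_upwards [eventually_hyperfilter_notMem v.support] with n hn
      have := hl (v + Finsupp.single n a)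
      rwa [sum_rpow_add_single hP v a hn, add_assoc, ← powSum_cons] at this
    exact ⟨h1, tendsto_nhds_limUnder (Ultrafilter.exists_tendsto_of_bounded _ h1)⟩
  induction l with
  | nil =>
    have : ∀ v, iterLim N [] v ∈
        Set.Icc (((v.sum fun _ c => ‖c‖ ^ P) + powSum P ([] : List 𝕜)) ^ (1 / P))
        (C * ((v.sum fun _ c => ‖c‖ ^ P) + powSum P ([] : List 𝕜)) ^ (1 / P)) := by
      intro v
      rw [powSum_nil, add_zero]
      exact hN v
    exact ⟨this, fun a v => (step _ this a v).2⟩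
  | cons b l ih =>
    have : ∀ v, iterLim N (b :: l) v ∈
        Set.Icc (((v.sum fun _ c => ‖c‖ ^ P) + powSum P (b :: l)) ^ (1 / P))
        (C * ((v.sum fun _ c => ‖c‖ ^ P) + powSum P (b :: l)) ^ (1 / P)) := by
      intro v
      obtain ⟨h1, h2⟩ := step _ ih.1 b v
      exact isClosed_Icc.mem_of_tendsto h2 h1
    exact ⟨this, fun a v => (step _ this a v).2⟩

theorem iterLim_add_le (hP : 1 ≤ P) (hadd : ∀ v w, N (v + w) ≤ N v + N w) (l l' : List 𝕜)
    (h : l.length = l'.length) (v w : ℕ →₀ 𝕜) :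
    iterLim N (List.zipWith (· + ·) l l') (v + w) ≤ iterLim N l v + iterLim N l' w := by
  induction l generalizing l' v w with
  | nil =>
    cases l' with
    | nil => exact hadd v w
    | cons a l' => simp at h
  | cons a l ih =>
    cases l' with
    | nil => simp at h
    | cons b l' =>
      refine le_of_tendsto_of_tendsto' ((iterLim_spec hN hP _).2 _ _)
        (((iterLim_spec hN hP _).2 a v).add ((iterLim_spec hN hP _).2 b w)) fun n => ?_
      have := ih l' (by simpa using h) (v + Finsupp.single n a) (w + Finsupp.single n b)
      rwa [add_add_add_comm, ← Finsupp.single_add] at this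

theorem iterLim_map_mul (hP : 1 ≤ P) (hsmul : ∀ (c : 𝕜) v, N (c • v) = ‖c‖ * N v) (c : 𝕜)
    (l : List 𝕜) (v : ℕ →₀ 𝕜) :
    iterLim N (l.map (c * ·)) (c • v) = ‖c‖ * iterLim N l v := by
  induction l generalizing v with
  | nil => exact hsmul c v
  | cons a l ih =>
    refine tendsto_nhds_unique ((iterLim_spec hN hP _).2 _ _)
      ((((iterLim_spec hN hP _).2 a v).const_mul ‖c‖).congr fun n => ?_)
    rw [← ih, smul_add, Finsupp.smul_single, smul_eq_mul]

theorem iterLim_insert_zero (hP : 1 ≤ P) (A B : List 𝕜) (v : ℕ →₀ 𝕜) :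
    iterLim N (A ++ 0 :: B) v = iterLim N (A ++ B) v := by
  induction A generalizing v with
  | nil =>
    refine tendsto_nhds_unique ((iterLim_spec hN hP _).2 _ _) ?_
    simp
  | cons a A ih =>
    refine tendsto_nhds_unique ((iterLim_spec hN hP _).2 _ _)
      (((iterLim_spec hN hP _).2 a v).congr fun n => ?_)
    exact (ih _).symm

/-- Iterated limits are approximated, simultaneously for finitely many words, by the values of
the norm itself. -/
theorem exists_forall_abs_iterLim_sub_lt (hP : 1 ≤ P) (k : ℕ)
    (F : Finset (List 𝕜 × (ℕ →₀ 𝕜))) (hF : ∀ x ∈ F, x.1.length ≤ k) (ε : ℝ) (hε : 0 < ε) :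
    ∃ y : ℕ → (ℕ →₀ 𝕜), ∀ x ∈ F, |N (x.2 + wordComb y x.1) - iterLim N x.1 x.2| < ε := by
  classical
  induction k generalizing F ε with
  | zero =>
    refine ⟨fun _ => 0, fun x hx => ?_⟩
    have : x.1 = [] := List.length_eq_zero_iff.1 (Nat.le_zero.1 (hF x hx))
    rw [this]
    simpa [iterLim] using hε
  | succ k ih =>
    have h1 : ∀ᶠ n in (hyperfilter ℕ : Filter ℕ), ∀ x ∈ F, ∀ a l, x.1 = a :: l →
        |iterLim N l (x.2 + Finsupp.single n a) - iterLim N (a :: l) x.2| < ε / 2 := by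
      rw [Finset.eventually_all]
      rintro ⟨l, v⟩ _
      cases l with
      | nil => simp
      | cons a l =>
        have := Metric.tendsto_nhds.1 ((iterLim_spec hN hP l).2 a v) (ε / 2) (by positivity)
        filter_upwards [this] with n hn
        rintro a' l' h
        obtain ⟨rfl, rfl⟩ := List.cons.inj h
        simpa [Real.dist_eq] using hn
    obtain ⟨n, hn⟩ := h1.exists
    obtain ⟨y, hy⟩ := ih (F.image fun x => (x.1.tail, x.2 + Finsupp.single n (x.1.headD 0)))
      (by
        intro x hx
        obtain ⟨z, hz, rfl⟩ := Finset.mem_image.1 hx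
        have := hF z hz
        simp only [List.length_tail]
        omega) (ε / 2) (by positivity)
    refine ⟨fun i => i.casesOn (Finsupp.single n 1) y, ?_⟩
    rintro ⟨l, v⟩ hx
    cases l with
    | nil => simpa [iterLim] using hε
    | cons a l =>
      have h2 := hy _ (Finset.mem_image_of_mem _ hx)
      have h3 := hn _ hx a l rfl
      simp only [List.tail_cons, List.headD_cons] at h2 h3
      have h4 : a • Finsupp.single n (1 : 𝕜) = Finsupp.single n a := by simp
      change |N (v + (a • Finsupp.single n (1 : 𝕜) + wordComb y l)) - _| < ε
      rw [h4, ← add_assoc]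
      have := abs_sub_le (N (v + Finsupp.single n a + wordComb y l))
        (iterLim N l (v + Finsupp.single n a)) (iterLim N (a :: l) v)
      linarith

end IterLim

/-- If `Y` contains, with one constant `C`, copies of the unit vector basis of `ℓ_P^n` for every
`n`, then there is a spreading norm with constant `C`: the norms of these copies have a limit on
finitely supported sequences along an ultrafilter, and the iterated limits of this limit norm do
not see the positions of the letters. -/
theorem exists_spreadingNorm {𝕜 : Type*} [RCLike 𝕜] {Y : Type*} [NormedAddCommGroup Y]
    [NormedSpace 𝕜 Y] {P C : ℝ} (hP : 1 ≤ P) (y : ℕ → ℕ → Y)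
    (hy : ∀ (n : ℕ) (v : ℕ →₀ 𝕜), v.support ⊆ Finset.range n →
      ‖Finsupp.linearCombination 𝕜 (y n) v‖ ∈ Set.Icc ((v.sum fun _ c => ‖c‖ ^ P) ^ (1 / P))
        (C * (v.sum fun _ c => ‖c‖ ^ P) ^ (1 / P))) :
    ∃ G : List 𝕜 → ℝ, SpreadingNorm Y P C G := by
  classical
  have hev : ∀ v : ℕ →₀ 𝕜, ∀ᶠ n in (hyperfilter ℕ : Filter ℕ),
      ‖Finsupp.linearCombination 𝕜 (y n) v‖ ∈ Set.Icc ((v.sum fun _ c => ‖c‖ ^ P) ^ (1 / P))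
        (C * (v.sum fun _ c => ‖c‖ ^ P) ^ (1 / P)) := by
    intro v
    have : ∀ᶠ n in atTop, v.support ⊆ Finset.range n := by
      obtain ⟨m, hm⟩ := v.support.exists_nat_subset_range
      filter_upwards [eventually_ge_atTop m] with n hn
      exact hm.trans (Finset.range_subset_range.2 hn)
    exact (this.filter_mono Nat.hyperfilter_le_atTop).mono fun n hn => hy n v hn
  choose N hN using fun v => Ultrafilter.exists_tendsto_of_bounded _ (hev v)
  have hb : ∀ v, N v ∈ Set.Icc ((v.sum fun _ c => ‖c‖ ^ P) ^ (1 / P))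
      (C * (v.sum fun _ c => ‖c‖ ^ P) ^ (1 / P)) :=
    fun v => isClosed_Icc.mem_of_tendsto (hN v) (hev v)
  have hadd : ∀ v w, N (v + w) ≤ N v + N w := fun v w =>
    le_of_tendsto_of_tendsto' (hN _) ((hN v).add (hN w)) fun n => by
      rw [map_add]; exact norm_add_le _ _
  have hsmul : ∀ (c : 𝕜) v, N (c • v) = ‖c‖ * N v := fun c v =>
    tendsto_nhds_unique (hN _) (((hN v).const_mul ‖c‖).congr fun n => by
      rw [map_smul, norm_smul])
  refine ⟨fun l => iterLim N l 0, fun l l' h => ?_, fun c l => ?_, fun A B => ?_, fun l => ?_,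
    fun l => ?_, fun F ε hε => ?_⟩
  · have := iterLim_add_le hb hP hadd l l' h 0 0
    rwa [add_zero] at this
  · have := iterLim_map_mul hb hP hsmul c l 0
    rwa [smul_zero] at this
  · exact iterLim_insert_zero hb hP A B 0
  · have := ((iterLim_spec hb hP l).1 0).1
    rwa [Finsupp.sum_zero_index, zero_add] at this
  · have := ((iterLim_spec hb hP l).1 0).2
    rwa [Finsupp.sum_zero_index, zero_add] at this
  · obtain ⟨z, hz⟩ := exists_forall_abs_iterLim_sub_lt hb hP (F.sup List.length)
      (F.image fun l => (l, 0)) (by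
        intro x hx
        obtain ⟨l, hl, rfl⟩ := Finset.mem_image.1 hx
        exact Finset.le_sup (f := List.length) hl) (ε / 2) (by positivity)
    have h1 : ∀ᶠ n in (hyperfilter ℕ : Filter ℕ), ∀ l ∈ F,
        |‖Finsupp.linearCombination 𝕜 (y n) (wordComb z l)‖ - N (wordComb z l)| < ε / 2 := by
      rw [Finset.eventually_all]
      intro l _
      have := Metric.tendsto_nhds.1 (hN (wordComb z l)) (ε / 2) (by positivity)
      simpa [Real.dist_eq] using this
    obtain ⟨n, hn⟩ := h1.exists
    refine ⟨fun i => Finsupp.linearCombination 𝕜 (y n) (z i), fun l hl => ?_⟩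
    have h2 := hn l hl
    have h3 := hz _ (Finset.mem_image_of_mem _ hl)
    rw [map_wordComb] at h2
    rw [zero_add] at h3
    have := abs_sub_le (‖wordComb (fun i => Finsupp.linearCombination 𝕜 (y n) (z i)) l‖)
      (N (wordComb z l)) (iterLim N l 0)
    linarith

/-! ### Improving the invariance of a spreading norm -/

/-- Multiplying one letter of a word by `ζ` does not increase `G`. -/
def ContractsLetter {𝕜 : Type*} [RCLike 𝕜] (G : List 𝕜 → ℝ) (ζ : 𝕜) : Prop :=
  ∀ (A B : List 𝕜) (c : 𝕜), G (A ++ ζ * c :: B) ≤ G (A ++ c :: B)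

theorem ContractsLetter.map_mul_le {𝕜 : Type*} [RCLike 𝕜] {G : List 𝕜 → ℝ} {ζ : 𝕜}
    (h : ContractsLetter G ζ) (A l B : List 𝕜) :
    G (A ++ (l.map (ζ * ·) ++ B)) ≤ G (A ++ (l ++ B)) := by
  induction l generalizing A with
  | nil => simp
  | cons c l ih =>
    refine (h A (l.map (ζ * ·) ++ B) c).trans ?_
    simpa using ih (A ++ [c])

namespace SpreadingNorm

variable {𝕜 : Type*} [RCLike 𝕜] {Y : Type*} [NormedAddCommGroup Y] [NormedSpace 𝕜 Y]
  {P C : ℝ} {G : List 𝕜 → ℝ}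

/-- Substituting words `u K` of norm tending to infinity and passing to the limit produces a
spreading norm which does not distinguish between words whose substitutions by `u K` stay at
bounded distance. -/
theorem exists_limit_subst (hP : 1 ≤ P) (hG : SpreadingNorm Y P C G) (u : ℕ → List 𝕜)
    (hu : ∀ K, powSum P (u K) = K + 1) :
    ∃ G' : List 𝕜 → ℝ, SpreadingNorm Y P C G' ∧
      (∀ ζ, ContractsLetter G ζ → ContractsLetter G' ζ) ∧
      ∀ (l l' : List 𝕜) (D : ℝ), (∀ K, |G (substWord (u K) l) - G (substWord (u K) l')| ≤ D) →
        G' l = G' l' := by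
  have hpos : ∀ K, 0 < powSum P (u K) := fun K => by rw [hu]; positivity
  have hH := fun K => hG.subst (hpos K)
  set H : ℕ → List 𝕜 → ℝ := fun K l => G (substWord (u K) l) / powSum P (u K) ^ (1 / P) with hHdef
  choose G' hG' using fun l => Ultrafilter.exists_tendsto_of_bounded (hyperfilter ℕ)
    (f := fun K => H K l) (Eventually.of_forall fun K => ⟨(hH K).lower l, (hH K).upper l⟩)
  refine ⟨G', of_tendsto hH hG', fun ζ hζ A B c => ?_, fun l l' D hD => ?_⟩
  · refine le_of_tendsto_of_tendsto' (hG' _) (hG' _) fun K => ?_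
    simp only [hHdef]
    refine div_le_div_of_nonneg_right ?_ (Real.rpow_nonneg (hpos K).le _)
    have := hζ.map_mul_le (substWord (u K) A) ((u K).map (c * ·)) (substWord (u K) B)
    simpa [mul_assoc] using this
  · have h1 : Tendsto (fun K : ℕ => D / ((K : ℝ) + 1) ^ (1 / P))
        (hyperfilter ℕ : Filter ℕ) (𝓝 0) := by
      refine Tendsto.mono_left ?_ Nat.hyperfilter_le_atTop
      refine Tendsto.const_div_atTop ?_ D
      exact (tendsto_rpow_atTop (by positivity)).comp
        (tendsto_atTop_add_const_right _ _ tendsto_natCast_atTop_atTop)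
    have h2 : Tendsto (fun K => H K l - H K l') (hyperfilter ℕ : Filter ℕ) (𝓝 0) := by
      refine squeeze_zero_norm (fun K => ?_) h1
      have hp := Real.rpow_pos_of_pos (hpos K) (1 / P)
      simp only [hHdef]
      rw [← sub_div, Real.norm_eq_abs, abs_div, abs_of_pos hp, ← hu K]
      gcongr
      exact hD K
    exact sub_eq_zero.1 (tendsto_nhds_unique ((hG' l).sub (hG' l')) h2)

/-- Invariance under multiplication of letters by a unimodular scalar `ζ` is obtained from the
words `1, ζ, …, ζ ^ K`: multiplying by `ζ` amounts to a shift by one letter. -/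
theorem exists_contractsLetter (hP : 1 ≤ P) (hG : SpreadingNorm Y P C G) {ζ : 𝕜}
    (hζ : ‖ζ‖ = 1) :
    ∃ G' : List 𝕜 → ℝ, SpreadingNorm Y P C G' ∧ ContractsLetter G' ζ ∧
      ∀ ξ, ContractsLetter G ξ → ContractsLetter G' ξ := by
  set u : ℕ → List 𝕜 := fun K => (List.range (K + 1)).map fun k => ζ ^ k with hu_def
  have hu : ∀ K, powSum P (u K) = K + 1 := by
    intro K
    simp [hu_def, powSum, Function.comp_def, hζ]
  obtain ⟨G', h1, h2, h3⟩ := hG.exists_limit_subst hP u hu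
  refine ⟨G', h1, fun A B c => (h3 _ _ (C * ‖c‖ + C * ‖c‖) fun K => ?_).le, h2⟩
  -- both words arise from the word with the block `c, c ζ, …, c ζ ^ (K + 1)` by deleting a letter
  have hsucc : u (K + 1) = 1 :: (u K).map (ζ * ·) := by
    simp only [hu_def, List.range_succ_eq_map (n := K + 1)]
    simp [Function.comp_def, pow_succ']
  have hsucc' : u (K + 1) = u K ++ [ζ ^ (K + 1)] := by
    simp only [hu_def, List.range_succ (n := K + 1), List.map_append, List.map_cons, List.map_nil]
  have e1 := hG.abs_delete_le hP (substWord (u K) A)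
    ((u K).map (fun x => ζ * c * x) ++ substWord (u K) B) c
  have e2 := hG.abs_delete_le hP (substWord (u K) A ++ (u K).map (c * ·))
    (substWord (u K) B) (c * ζ ^ (K + 1))
  have e3 : substWord (u K) A ++ c :: ((u K).map (fun x => ζ * c * x) ++ substWord (u K) B) =
      substWord (u K) A ++ ((u (K + 1)).map (c * ·) ++ substWord (u K) B) := by
    rw [hsucc]
    simp [Function.comp_def, mul_assoc, mul_left_comm]
  have e4 : (substWord (u K) A ++ (u K).map (c * ·)) ++ c * ζ ^ (K + 1) :: substWord (u K) B =
      substWord (u K) A ++ ((u (K + 1)).map (c * ·) ++ substWord (u K) B) := by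
    rw [hsucc']
    simp
  rw [e3] at e1
  rw [e4, norm_mul, norm_pow, hζ, one_pow, mul_one, List.append_assoc] at e2
  rw [substWord_append, substWord_append, substWord_cons, substWord_cons]
  rw [abs_sub_comm] at e1
  exact (abs_sub_le _ _ _).trans (add_le_add e1 e2)

end SpreadingNorm

/-- The self-similar words `w₀ = 1`, `w_{K+1} = 1 (a w_K) (a w_K)`. -/
def dyadicWord {𝕜 : Type*} [RCLike 𝕜] (a : 𝕜) : ℕ → List 𝕜
  | 0 => [1]
  | K + 1 => 1 :: ((dyadicWord a K).map (a * ·) ++ (dyadicWord a K).map (a * ·))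

theorem powSum_dyadicWord {𝕜 : Type*} [RCLike 𝕜] {P : ℝ} {a : 𝕜} (ha : ‖a‖ ^ P = 1 / 2) (K : ℕ) :
    powSum P (dyadicWord a K) = K + 1 := by
  induction K with
  | zero => simp [dyadicWord]
  | succ K ih =>
    simp only [dyadicWord, powSum_cons, powSum_append, powSum_map_mul, ih, ha, norm_one,
      Real.one_rpow]
    push_cast
    ring

/-- The word `w_{K+1}` is obtained from `w_K` by inserting letters whose `ℓ_P`-norm is `1`. -/
theorem dyadicWord_succ_eq_zipWith {𝕜 : Type*} [RCLike 𝕜] {P : ℝ} (hP : 1 ≤ P) {a : 𝕜}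
    (ha : ‖a‖ ^ P = 1 / 2) (K : ℕ) :
    ∃ v z : List 𝕜, v.length = z.length ∧
      List.zipWith (· + ·) v z = dyadicWord a (K + 1) ∧ powSum P z = 1 ∧
      v.filter (fun c => decide (c ≠ 0)) =
        (dyadicWord a K).filter (fun c => decide (c ≠ 0)) := by
  have hP0 : P ≠ 0 := by linarith
  have ha0 : a ≠ 0 := by
    rintro rfl
    rw [norm_zero, Real.zero_rpow hP0] at ha
    norm_num at ha
  induction K with
  | zero =>
    refine ⟨[1, 0, 0], [0, a, a], rfl, by simp [dyadicWord], ?_, by simp [dyadicWord]⟩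
    simp only [powSum_cons, ha, powSum_nil, norm_zero, Real.zero_rpow hP0]
    norm_num
  | succ K ih =>
    obtain ⟨v, z, h1, h2, h3, h4⟩ := ih
    refine ⟨1 :: (v.map (a * ·) ++ v.map (a * ·)), 0 :: (z.map (a * ·) ++ z.map (a * ·)),
      by simp [h1], ?_, ?_, ?_⟩
    · have : List.zipWith (· + ·) (v.map (a * ·)) (z.map (a * ·)) =
          (dyadicWord a (K + 1)).map (a * ·) := by
        rw [← h2, List.zipWith_map, List.map_zipWith]
        simp only [mul_add]
      rw [List.zipWith_cons_cons, List.zipWith_append (by simp [h1]), this, add_zero]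
      rfl
    · simp only [powSum_cons, powSum_append, powSum_map_mul, h3, ha, norm_zero,
        Real.zero_rpow hP0]
      norm_num
    · have : ∀ l : List 𝕜, (l.map (a * ·)).filter (fun c => decide (c ≠ 0)) =
          (l.filter (fun c => decide (c ≠ 0))).map (a * ·) := by
        intro l
        rw [List.filter_map]
        simp [Function.comp_def, ha0]
      simp only [dyadicWord, List.filter_cons, List.filter_append, this, h4]

namespace SpreadingNorm

variable {𝕜 : Type*} [RCLike 𝕜] {Y : Type*} [NormedAddCommGroup Y] [NormedSpace 𝕜 Y]
  {P C : ℝ} {G : List 𝕜 → ℝ}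

/-- From the words `dyadicWord a K` with `|a| = 2 ^ (-1/P)` one obtains a norm for which the
letter `c` may be split in two letters `a c`, as in `ℓ_P`. -/
theorem exists_split (hP : 1 ≤ P) (hG : SpreadingNorm Y P C G) {a : 𝕜}
    (ha : ‖a‖ ^ P = 1 / 2) :
    ∃ G' : List 𝕜 → ℝ, SpreadingNorm Y P C G' ∧
      (∀ ξ, ContractsLetter G ξ → ContractsLetter G' ξ) ∧
      ∀ (A B : List 𝕜) (c : 𝕜), G' (A ++ c :: B) = G' (A ++ a * c :: a * c :: B) := by
  obtain ⟨G', h1, h2, h3⟩ := hG.exists_limit_subst hP (dyadicWord a) (powSum_dyadicWord ha)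
  refine ⟨G', h1, h2, fun A B c => h3 _ _ (‖c‖ * C + C * ‖c‖) fun K => ?_⟩
  set u := dyadicWord a K with hu
  obtain ⟨v, z, hvz, hsum, hz, hfil⟩ := dyadicWord_succ_eq_zipWith hP ha K
  have e1 := hG.abs_delete_le hP (substWord u A)
    (u.map (fun x => a * c * x) ++ (u.map (fun x => a * c * x) ++ substWord u B)) c
  have e2 : substWord u A ++ c :: (u.map (fun x => a * c * x) ++
      (u.map (fun x => a * c * x) ++ substWord u B)) =
      substWord u A ++ ((dyadicWord a (K + 1)).map (c * ·) ++ substWord u B) := by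
    simp [dyadicWord, ← hu, Function.comp_def, mul_left_comm, mul_assoc]
  have e3 := hG.abs_append_zipWith_sub_le (substWord u A) (substWord u B)
    (v := v.map (c * ·)) (z := z.map (c * ·)) (by simp [hvz])
  have e4 : List.zipWith (· + ·) (v.map (c * ·)) (z.map (c * ·)) =
      (dyadicWord a (K + 1)).map (c * ·) := by
    rw [← hsum, List.zipWith_map, List.map_zipWith]
    simp only [mul_add]
  have e5 : G (substWord u A ++ (v.map (c * ·) ++ substWord u B)) =
      G (substWord u A ++ (u.map (c * ·) ++ substWord u B)) := by
    by_cases hc : c = 0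
    · subst hc
      have h0 : ∀ l : List 𝕜, l.map ((0 : 𝕜) * ·) = List.replicate l.length 0 := fun l => by simp
      rw [h0, h0, hG.insert_replicate_zero, hG.insert_replicate_zero]
    · apply hG.append_eq_of_filter_eq
      have : ∀ l : List 𝕜, (l.map (c * ·)).filter (fun c => decide (c ≠ 0)) =
          (l.filter (fun c => decide (c ≠ 0))).map (c * ·) := by
        intro l
        rw [List.filter_map]
        simp [Function.comp_def, hc]
      rw [this, this, hfil]
  have e6 : G (z.map (c * ·)) ≤ ‖c‖ * C := by
    rw [hG.map_mul]
    gcongr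
    simpa [hz] using hG.upper z
  rw [e4, e5] at e3
  rw [e2] at e1
  rw [substWord_append, substWord_append, substWord_cons, substWord_cons, substWord_cons]
  rw [abs_sub_comm] at e3
  exact (abs_sub_le _ _ _).trans (add_le_add (e3.trans e6) e1)

/-- The norm is a convex function of each letter. -/
theorem letter_add_le (hG : SpreadingNorm Y P C G) (A B : List 𝕜) (x y : 𝕜) {s t : ℝ}
    (hs : 0 ≤ s) (ht : 0 ≤ t) (hst : s + t = 1) :
    G (A ++ ((s : 𝕜) * x + (t : 𝕜) * y) :: B) ≤ s * G (A ++ x :: B) + t * G (A ++ y :: B) := by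
  have h := hG.add_le ((A ++ x :: B).map ((s : 𝕜) * ·)) ((A ++ y :: B).map ((t : 𝕜) * ·)) (by simp)
  have hst' : (s : 𝕜) + (t : 𝕜) = 1 := by rw [← RCLike.ofReal_add, hst, RCLike.ofReal_one]
  rw [hG.map_mul, hG.map_mul, RCLike.norm_ofReal, RCLike.norm_ofReal, abs_of_nonneg hs,
    abs_of_nonneg ht] at h
  simp only [List.map_append, List.map_cons] at h
  rw [List.zipWith_append (by simp), List.zipWith_cons_cons, zipWith_add_map_mul,
    zipWith_add_map_mul, hst'] at h
  simpa using h

theorem letter_ofReal_mul_le (hG : SpreadingNorm Y P C G) (h1 : ContractsLetter G (-1))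
    (A B : List 𝕜) (x : 𝕜) {t : ℝ} (ht : |t| ≤ 1) :
    G (A ++ ((t : 𝕜) * x) :: B) ≤ G (A ++ x :: B) := by
  obtain ⟨ht1, ht2⟩ := abs_le.1 ht
  have h := hG.letter_add_le A B x (-1 * x) (s := (1 + t) / 2) (t := (1 - t) / 2)
    (by linarith) (by linarith) (by ring)
  have e : (((1 + t) / 2 : ℝ) : 𝕜) * x + (((1 - t) / 2 : ℝ) : 𝕜) * (-1 * x) = (t : 𝕜) * x := by
    push_cast; ring
  rw [e] at h
  nlinarith [h1 A B x]

/-- A norm contracted by the scalars `-1` and `I` is a lattice norm up to the factor `3/2`: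
the square with vertices `±1`, `±I` contains the disc of radius `2/3`. -/
theorem letter_mul_le (hG : SpreadingNorm Y P C G) (h1 : ContractsLetter G (-1))
    (h2 : ContractsLetter G (RCLike.I : 𝕜)) (A B : List 𝕜) (x z : 𝕜) (hz : ‖z‖ ≤ 2 / 3) :
    G (A ++ (z * x) :: B) ≤ G (A ++ x :: B) := by
  set a := RCLike.re z
  set b := RCLike.im z
  have hab : |a| + |b| ≤ 1 := by
    have h3 : a ^ 2 + b ^ 2 ≤ (2 / 3) ^ 2 := by
      have := RCLike.norm_sq_eq_def (z := z)
      have h4 : ‖z‖ ^ 2 ≤ (2 / 3) ^ 2 := by gcongr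
      simp only [a, b]
      nlinarith
    rw [← sq_abs a, ← sq_abs b] at h3
    nlinarith [sq_nonneg (|a| - |b|), abs_nonneg a, abs_nonneg b]
  have hz' : z = (a : 𝕜) + (b : 𝕜) * RCLike.I := (RCLike.re_add_im z).symm
  rcases (abs_nonneg a).eq_or_lt with ha | ha
  · have ha0 : a = 0 := abs_eq_zero.1 ha.symm
    rw [hz', ha0]
    simp only [RCLike.ofReal_zero, zero_add, mul_assoc]
    refine (hG.letter_ofReal_mul_le h1 A B _ ?_).trans (h2 A B x)
    linarith
  · -- write `z = |a| (±1) + (1 - |a|) t I` with `|t| ≤ 1`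
    rcases eq_or_ne |a| 1 with ha1 | ha1
    · have hb0 : b = 0 := abs_eq_zero.1 (le_antisymm (by linarith) (abs_nonneg b))
      rw [hz', hb0]
      simp only [RCLike.ofReal_zero, add_zero, zero_mul]
      exact hG.letter_ofReal_mul_le h1 A B _ ha1.le
    · have ha2 : 0 < 1 - |a| := by
        have : |a| < 1 := lt_of_le_of_ne (by linarith [abs_nonneg b]) ha1
        linarith
      have h := hG.letter_add_le A B (((a / |a| : ℝ) : 𝕜) * x)
        (((b / (1 - |a|) : ℝ) : 𝕜) * (RCLike.I * x)) (s := |a|) (t := 1 - |a|)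
        ha.le ha2.le (by ring)
      have e : ((|a| : ℝ) : 𝕜) * (((a / |a| : ℝ) : 𝕜) * x) + ((1 - |a| : ℝ) : 𝕜) *
          (((b / (1 - |a|) : ℝ) : 𝕜) * (RCLike.I * x)) = z * x := by
        rw [← mul_assoc, ← mul_assoc, ← RCLike.ofReal_mul, ← RCLike.ofReal_mul,
          mul_div_cancel₀ _ ha.ne', mul_div_cancel₀ _ ha2.ne', ← mul_assoc, ← add_mul, ← hz']
      rw [e] at h
      have h3 := hG.letter_ofReal_mul_le h1 A B x (t := a / |a|) (by
        rw [abs_div, abs_abs, div_self ha.ne'])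
      have h4 := (hG.letter_ofReal_mul_le h1 A B (RCLike.I * x) (t := b / (1 - |a|)) (by
        rw [abs_div, abs_of_pos ha2, div_le_one ha2]; linarith)).trans (h2 A B x)
      nlinarith

/-- A letter `x` with `x = a⁻ⁱ d` may be replaced by `2 ^ i` letters `d`. -/
theorem letter_eq_replicate {a : 𝕜}
    (hs : ∀ (A B : List 𝕜) (c : 𝕜), G (A ++ c :: B) = G (A ++ a * c :: a * c :: B))
    (i : ℕ) (A B : List 𝕜) (c : 𝕜) :
    G (A ++ c :: B) = G (A ++ (List.replicate (2 ^ i) (a ^ i * c) ++ B)) := by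
  induction i generalizing A B c with
  | zero => simp
  | succ i ih =>
    rw [hs, ih, pow_succ 2, mul_two, List.replicate_add]
    have := ih (A ++ List.replicate (2 ^ i) (a ^ i * (a * c))) B (a * c)
    rw [List.append_assoc, List.append_assoc] at this
    rw [this, pow_succ]
    simp only [mul_assoc, List.append_assoc]

theorem replicate_mono (hG : SpreadingNorm Y P C G) (h1 : ContractsLetter G (-1)) (d : 𝕜)
    {m n : ℕ} (h : m ≤ n) : G (List.replicate m d) ≤ G (List.replicate n d) := by
  induction n, h using Nat.le_induction with
  | base => exact le_rfl
  | succ n _ ih =>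
    refine ih.trans ?_
    have := hG.letter_ofReal_mul_le h1 [] (List.replicate n d) d (t := 0) (by simp)
    rw [RCLike.ofReal_zero, zero_mul, hG.insert_zero] at this
    simpa [List.replicate_succ] using this

/-- A letter `c` is compared, from below and from above, with a number of small equal letters
`a ^ J` which is `‖c‖ ^ P 2 ^ J` up to a factor `2`. -/
theorem eventually_letter_compare (hP : 1 ≤ P) (hG : SpreadingNorm Y P C G)
    (h1 : ContractsLetter G (-1)) (h2 : ContractsLetter G (RCLike.I : 𝕜)) {a : ℝ} (ha0 : 0 < a)
    (ha : a ^ P = 1 / 2)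
    (hs : ∀ (A B : List 𝕜) (c : 𝕜), G (A ++ c :: B) = G (A ++ (a : 𝕜) * c :: (a : 𝕜) * c :: B))
    (c : 𝕜) : ∀ᶠ J : ℕ in atTop, ∃ m m' : ℕ, ‖c‖ ^ P * 2 ^ J ≤ 2 * m ∧
      (m' : ℝ) ≤ 2 * (‖c‖ ^ P * 2 ^ J) ∧ ∀ A B,
        G (A ++ (List.replicate m ((2 / 3 : 𝕜) * (a : 𝕜) ^ J) ++ B)) ≤ G (A ++ c :: B) ∧
        G (A ++ c :: B) ≤ G (A ++ (List.replicate m' ((3 / 2 : 𝕜) * (a : 𝕜) ^ J) ++ B)) := by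
  have hP0 : 0 < P := by linarith
  have ha' : (a : 𝕜) ≠ 0 := by exact_mod_cast ha0.ne'
  rcases eq_or_ne c 0 with rfl | hc
  · refine Eventually.of_forall fun J => ⟨0, 0, ?_, ?_, fun A B => ?_⟩
    · simp [Real.zero_rpow hP0.ne']
    · simp [Real.zero_rpow hP0.ne']
    · simp [hG.insert_zero]
  have hcn : 0 < ‖c‖ := norm_pos_iff.2 hc
  have hcP : 0 < ‖c‖ ^ P := Real.rpow_pos_of_pos hcn P
  have hlim : Tendsto (fun J : ℕ => ‖c‖ ^ P * (2 : ℝ) ^ J) atTop atTop :=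
    (tendsto_pow_atTop_atTop_of_one_lt one_lt_two).const_mul_atTop hcP
  filter_upwards [hlim.eventually_ge_atTop 1] with J hJ
  obtain ⟨i, hi1, hi2⟩ := exists_nat_pow_near hJ one_lt_two
  have hpow : ∀ k : ℕ, (a ^ J / a ^ k) ^ P = 2 ^ k / 2 ^ J := by
    intro k
    have : ∀ n : ℕ, (a ^ n) ^ P = 1 / 2 ^ n := by
      intro n
      rw [← Real.rpow_natCast, ← Real.rpow_mul ha0.le, mul_comm, Real.rpow_mul ha0.le, ha,
        Real.rpow_natCast]
      simp
    rw [Real.div_rpow (by positivity) (by positivity), this, this]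
    field_simp
  refine ⟨2 ^ i, 2 ^ (i + 1), ?_, ?_, fun A B => ⟨?_, ?_⟩⟩
  · push_cast; rw [pow_succ] at hi2; linarith
  · push_cast; rw [pow_succ]; linarith
  · -- the letter `b = a ^ (J - i)` satisfies `‖b‖ ≤ ‖c‖`
    have hb : a ^ J / a ^ i ≤ ‖c‖ := by
      rw [← Real.rpow_le_rpow_iff (by positivity) hcn.le hP0, hpow, div_le_iff₀ (by positivity)]
      exact hi1
    have h := hG.letter_mul_le h1 h2 A B c ((2 / 3 : 𝕜) * ((a ^ J / a ^ i : ℝ) : 𝕜) / c) (by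
      rw [norm_div, norm_mul, RCLike.norm_ofReal, abs_of_nonneg (by positivity),
        div_le_iff₀ hcn]
      have : ‖(2 / 3 : 𝕜)‖ = 2 / 3 := by simp
      rw [this]
      gcongr)
    rw [div_mul_cancel₀ _ hc, letter_eq_replicate hs i] at h
    convert h using 4
    push_cast
    field_simp
  · have hb : ‖c‖ ≤ a ^ J / a ^ (i + 1) := by
      rw [← Real.rpow_le_rpow_iff hcn.le (by positivity) hP0, hpow, le_div_iff₀ (by positivity)]
      exact hi2.le
    have hbpos : 0 < a ^ J / a ^ (i + 1) := by positivity
    have hb0 : ((a ^ J / a ^ (i + 1) : ℝ) : 𝕜) ≠ 0 := by exact_mod_cast hbpos.ne'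
    have h := hG.letter_mul_le h1 h2 A B ((3 / 2 : 𝕜) * ((a ^ J / a ^ (i + 1) : ℝ) : 𝕜))
      (c / ((3 / 2 : 𝕜) * ((a ^ J / a ^ (i + 1) : ℝ) : 𝕜))) (by
      rw [norm_div, norm_mul, RCLike.norm_ofReal, abs_of_pos hbpos, div_le_iff₀]
      · have : ‖(3 / 2 : 𝕜)‖ = 3 / 2 := by simp
        rw [this]
        linarith
      · have : ‖(3 / 2 : 𝕜)‖ = 3 / 2 := by simp
        rw [this]
        positivity)
    rw [div_mul_cancel₀ _ (mul_ne_zero (by norm_num) hb0), letter_eq_replicate hs (i + 1) A B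
      ((3 / 2 : 𝕜) * _)] at h
    convert h using 4
    push_cast
    field_simp

/-- The comparison of letters, applied to all letters of a word in turn: for large `J` the word
is enclosed between two constant words with letters proportional to `a ^ J`. -/
theorem eventually_word_compare (hP : 1 ≤ P) (hG : SpreadingNorm Y P C G)
    (h1 : ContractsLetter G (-1)) (h2 : ContractsLetter G (RCLike.I : 𝕜)) {a : ℝ} (ha0 : 0 < a)
    (ha : a ^ P = 1 / 2)
    (hs : ∀ (A B : List 𝕜) (c : 𝕜), G (A ++ c :: B) = G (A ++ (a : 𝕜) * c :: (a : 𝕜) * c :: B))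
    (l : List 𝕜) : ∀ᶠ J : ℕ in atTop, ∃ m m' : ℕ, powSum P l * 2 ^ J ≤ 2 * m ∧
      (m' : ℝ) ≤ 2 * (powSum P l * 2 ^ J) ∧ ∀ A,
        G (A ++ List.replicate m ((2 / 3 : 𝕜) * (a : 𝕜) ^ J)) ≤ G (A ++ l) ∧
        G (A ++ l) ≤ G (A ++ List.replicate m' ((3 / 2 : 𝕜) * (a : 𝕜) ^ J)) := by
  induction l with
  | nil => exact Eventually.of_forall fun J => ⟨0, 0, by simp⟩
  | cons c l ih =>
    filter_upwards [ih, hG.eventually_letter_compare hP h1 h2 ha0 ha hs c] with J hJ hJ'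
    obtain ⟨m, m', hm, hm', hl⟩ := hJ
    obtain ⟨n, n', hn, hn', hc⟩ := hJ'
    refine ⟨n + m, n' + m', ?_, ?_, fun A => ⟨?_, ?_⟩⟩
    · rw [powSum_cons]; push_cast; linarith
    · rw [powSum_cons]; push_cast; linarith
    · rw [List.replicate_add]
      refine le_trans ?_ (hc A l).1
      rw [← List.append_assoc, ← List.append_assoc]
      exact (hl _).1
    · rw [List.replicate_add]
      refine (hc A l).2.trans ?_
      rw [← List.append_assoc, ← List.append_assoc]
      exact (hl _).2

/-- If the norm is, up to a constant, a lattice norm and letters can be split as in `ℓ_P`, then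
it is equivalent to the `ℓ_P`-norm with an absolute constant. -/
theorem bounds_of_split (hP : 1 ≤ P) (hG : SpreadingNorm Y P C G) (h1 : ContractsLetter G (-1))
    (h2 : ContractsLetter G (RCLike.I : 𝕜)) {a : ℝ} (ha0 : 0 < a) (ha : a ^ P = 1 / 2)
    (hs : ∀ (A B : List 𝕜) (c : 𝕜), G (A ++ c :: B) = G (A ++ (a : 𝕜) * c :: (a : 𝕜) * c :: B))
    {l : List 𝕜} (hl : powSum P l = 1) : G [1] ≤ 3 * G l ∧ G l ≤ 3 * G [1] := by
  have ha' : (a : 𝕜) ≠ 0 := by exact_mod_cast ha0.ne'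
  have ha1 : a ≤ 1 := by
    by_contra! h
    have := Real.one_lt_rpow h (by linarith : 0 < P)
    linarith
  have ha2 : 1 / 2 ≤ a := by
    rw [← ha]
    calc a ^ P ≤ a ^ (1 : ℝ) := Real.rpow_le_rpow_of_exponent_ge ha0 ha1 hP
      _ = a := Real.rpow_one a
  obtain ⟨J, ⟨m, m', hm, hm', hJ⟩, hJ1⟩ :=
    ((hG.eventually_word_compare hP h1 h2 ha0 ha hs l).and (eventually_ge_atTop 1)).exists
  obtain ⟨hlow, hupp⟩ := hJ []
  simp only [List.nil_append] at hlow hupp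
  have hrep : ∀ (n : ℕ) (t : ℝ), 0 ≤ t → G (List.replicate n ((t : 𝕜) * (a : 𝕜) ^ J)) =
      t * G (List.replicate n ((a : 𝕜) ^ J)) := by
    intro n t ht
    have := hG.map_mul (t : 𝕜) (List.replicate n ((a : 𝕜) ^ J))
    rwa [List.map_replicate, RCLike.norm_ofReal, abs_of_nonneg ht] at this
  have hsing : ∀ t : ℝ, 0 ≤ t → G [(t : 𝕜)] = t * G [1] := by
    intro t ht
    have := hG.map_mul (t : 𝕜) [1]
    rw [RCLike.norm_ofReal, abs_of_nonneg ht] at this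
    simpa using this
  have e1 : (2 / 3 : 𝕜) = ((2 / 3 : ℝ) : 𝕜) := by push_cast; rfl
  have e2 : (3 / 2 : 𝕜) = ((3 / 2 : ℝ) : 𝕜) := by push_cast; rfl
  rw [e1, hrep _ _ (by norm_num)] at hlow
  rw [e2, hrep _ _ (by norm_num)] at hupp
  rw [hl, one_mul] at hm hm'
  obtain ⟨J, rfl⟩ : ∃ J', J = J' + 1 := ⟨J - 1, by omega⟩
  constructor
  · have h3 : 2 ^ J ≤ m := by
      have : (2 : ℝ) ^ J ≤ m := by rw [pow_succ] at hm; linarith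
      exact_mod_cast this
    have h4 := hG.replicate_mono h1 ((a : 𝕜) ^ (J + 1)) h3
    have h5 := letter_eq_replicate hs J [] [] (a : 𝕜)
    simp only [List.nil_append, List.append_nil, ← pow_succ] at h5
    rw [← h5, hsing a ha0.le] at h4
    nlinarith [hG.nonneg [1]]
  · have h3 : m' ≤ 2 ^ (J + 1 + 1) := by
      have : (m' : ℝ) ≤ 2 ^ (J + 1 + 1) := by rw [pow_succ _ (J + 1)]; linarith
      exact_mod_cast this
    have h4 := hG.replicate_mono h1 ((a : 𝕜) ^ (J + 1)) h3
    have h5 := letter_eq_replicate hs (J + 1 + 1) [] [] ((a⁻¹ : ℝ) : 𝕜)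
    have h6 : (a : 𝕜) ^ (J + 1 + 1) * ((a⁻¹ : ℝ) : 𝕜) = (a : 𝕜) ^ (J + 1) := by
      push_cast; rw [pow_succ, mul_assoc, mul_inv_cancel₀ ha', mul_one]
    rw [h6] at h5
    simp only [List.nil_append, List.append_nil] at h5
    rw [← h5, hsing _ (by positivity)] at h4
    have h7 : a⁻¹ ≤ 2 := by
      rw [inv_le_comm₀ ha0 two_pos]; linarith
    nlinarith [hG.nonneg [1]]

/-- A spreading norm can be replaced by one which is equivalent to the `ℓ_P`-norm with an
absolute constant. -/
theorem exists_absolute (hP : 1 ≤ P) (hG : SpreadingNorm Y P C G) :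
    ∃ G' : List 𝕜 → ℝ, SpreadingNorm Y P C G' ∧ ∃ g : ℝ, 0 < g ∧
      ∀ l, powSum P l = 1 → g ≤ G' l ∧ G' l ≤ 9 * g := by
  obtain ⟨G₁, hG₁, h₁, -⟩ := hG.exists_contractsLetter hP (ζ := -1) (by simp)
  obtain ⟨G₂, hG₂, h₂, h₂'⟩ : ∃ G₂ : List 𝕜 → ℝ, SpreadingNorm Y P C G₂ ∧
      ContractsLetter G₂ (-1) ∧ ContractsLetter G₂ (RCLike.I : 𝕜) := by
    -- in the real case `I = 0`
    rcases eq_or_ne (RCLike.I : 𝕜) 0 with hI | hI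
    · refine ⟨G₁, hG₁, h₁, fun A B c => ?_⟩
      have := hG₁.letter_ofReal_mul_le h₁ A B c (t := 0) (by simp)
      rwa [RCLike.ofReal_zero, ← hI] at this
    · obtain ⟨G₂, hG₂, h₂, h₂'⟩ := hG₁.exists_contractsLetter hP (ζ := (RCLike.I : 𝕜))
        (RCLike.norm_I_of_ne_zero hI)
      exact ⟨G₂, hG₂, h₂' _ h₁, h₂⟩
  have hP0 : P ≠ 0 := by linarith
  set a : ℝ := (1 / 2) ^ (1 / P) with ha_def
  have ha0 : 0 < a := by positivity
  have ha : a ^ P = 1 / 2 := by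
    rw [ha_def, ← Real.rpow_mul (by norm_num), one_div_mul_cancel hP0, Real.rpow_one]
  obtain ⟨G₃, hG₃, h₃, hs⟩ := hG₂.exists_split hP (a := (a : 𝕜)) (by
    rw [RCLike.norm_ofReal, abs_of_pos ha0, ha])
  have hone : (1 : ℝ) ≤ G₃ [1] := by simpa using hG₃.lower [1]
  refine ⟨G₃, hG₃, G₃ [1] / 3, by positivity, fun l hl => ?_⟩
  obtain ⟨h5, h6⟩ := hG₃.bounds_of_split hP (h₃ _ h₂) (h₃ _ h₂') ha0 ha hs hl
  constructor <;> linarith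

end SpreadingNorm

/-! ### Copies of `ℓ_p^n` with an absolute constant -/

/-- `Y` contains, for every `n`, a linear image of `ℓ_p^n` with distortion at most `D`. -/
def HasCopies (𝕜 : Type*) [RCLike 𝕜] (p : ℝ≥0∞) [Fact (1 ≤ p)] (D : ℝ)
    (Y : Type*) [NormedAddCommGroup Y] [NormedSpace 𝕜 Y] : Prop :=
  ∀ n : ℕ, ∃ T : PiLp p (fun _ : Fin n => 𝕜) →ₗ[𝕜] Y, ∀ a, ‖a‖ ≤ ‖T a‖ ∧ ‖T a‖ ≤ D * ‖a‖

section

variable {𝕜 : Type*} [RCLike 𝕜] {p : ℝ≥0∞} [Fact (1 ≤ p)]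
    {Y : Type*} [NormedAddCommGroup Y] [NormedSpace 𝕜 Y]

theorem ContainsEllpUniformly.exists_hasCopies (hY : ContainsEllpUniformly 𝕜 p Y) :
    ∃ C : ℝ, HasCopies 𝕜 p C Y := by
  obtain ⟨lam, h1, E, hE⟩ := hY
  refine ⟨lam + 1, fun n => ?_⟩
  rcases Nat.eq_zero_or_pos n with rfl | hn
  · refine ⟨0, fun a => ?_⟩
    have : a = 0 := Subsingleton.elim _ _
    simp [this]
  · have h2 : banachMazurDist 𝕜 (E n) (PiLp p (fun _ : Fin n => 𝕜)) < ENNReal.ofReal (lam + 1) :=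
      (hE n hn).trans_lt ((ENNReal.ofReal_lt_ofReal_iff (by linarith)).2 (by linarith))
    obtain ⟨T, hT⟩ := iInf_lt_iff.1 h2
    have hT' := (ENNReal.ofReal_lt_ofReal_iff (by linarith)).1 hT
    refine ⟨((‖(T : E n →L[𝕜] PiLp p (fun _ : Fin n => 𝕜))‖ : ℝ) : 𝕜) •
      ((E n).subtype ∘ₗ (T.symm : PiLp p (fun _ : Fin n => 𝕜) →ₗ[𝕜] E n)), fun a => ?_⟩
    have h3 := (T.symm : PiLp p (fun _ : Fin n => 𝕜) →L[𝕜] E n).le_opNorm a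
    have h4 := (T : E n →L[𝕜] PiLp p (fun _ : Fin n => 𝕜)).le_opNorm (T.symm a)
    simp only [ContinuousLinearEquiv.coe_coe, ContinuousLinearEquiv.apply_symm_apply] at h3 h4
    simp only [LinearMap.smul_apply, LinearMap.comp_apply, norm_smul, RCLike.norm_ofReal,
      abs_norm]
    refine ⟨h4, ?_⟩
    refine (mul_le_mul_of_nonneg_left h3 (norm_nonneg _)).trans ?_
    rw [← mul_assoc]
    gcongr

/-- If a finite-dimensional norm is approximated at finitely many points, up to any `ε`, by
images of linear maps, then it is so uniformly, up to a small factor. -/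
theorem exists_linearMap_of_finset_approx {X : Type*} [NormedAddCommGroup X] [NormedSpace 𝕜 X]
    [FiniteDimensional 𝕜 X] {N : X → ℝ} {g : ℝ} (hg : 0 < g)
    (hN : ∀ x, ‖x‖ = 1 → g ≤ N x ∧ N x ≤ 9 * g)
    (happ : ∀ F : Finset X, ∀ ε > 0, ∃ T : X →ₗ[𝕜] Y, ∀ x ∈ F, |‖T x‖ - N x| < ε) :
    ∃ T : X →ₗ[𝕜] Y, ∀ x, ‖x‖ ≤ ‖T x‖ ∧ ‖T x‖ ≤ 10 * ‖x‖ := by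
  have : ProperSpace X := FiniteDimensional.proper_rclike 𝕜 X
  obtain ⟨F, hFs, hF⟩ := (isCompact_sphere (0 : X) 1).elim_finite_subcover_image
    (b := Metric.sphere (0 : X) 1) (c := fun x => Metric.ball x (1 / 1000))
    (fun x _ => Metric.isOpen_ball) (fun x hx => Set.mem_iUnion₂.2 ⟨x, hx, by simp⟩)
  obtain ⟨hFfin, hF⟩ := hF
  obtain ⟨T, hT⟩ := happ hFfin.toFinset (g / 1000) (by positivity)
  set T' : X →L[𝕜] Y := LinearMap.toContinuousLinearMap T
  have hnet : ∀ x : X, ‖x‖ = 1 → ∃ f ∈ F, ‖x - f‖ ≤ 1 / 1000 := by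
    intro x hx
    obtain ⟨f, hf, hxf⟩ := Set.mem_iUnion₂.1 (hF (by simpa using hx : x ∈ Metric.sphere (0 : X) 1))
    exact ⟨f, hf, by rw [← dist_eq_norm]; exact (Metric.mem_ball.1 hxf).le⟩
  have hval : ∀ f ∈ F, g * (999 / 1000) ≤ ‖T f‖ ∧ ‖T f‖ ≤ g * 9.001 := by
    intro f hf
    have h1 := abs_lt.1 (hT f (hFfin.mem_toFinset.2 hf))
    have h2 := hN f (by simpa using hFs hf)
    constructor <;> linarith
  have hdiff : ∀ x f : X, ‖x - f‖ ≤ 1 / 1000 → ‖T x - T f‖ ≤ ‖T'‖ * (1 / 1000) := by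
    intro x f h
    rw [← map_sub]
    exact (T'.le_opNorm _).trans (by gcongr)
  have hop : ‖T'‖ ≤ g * 9.001 + ‖T'‖ * (1 / 1000) := by
    refine T'.opNorm_le_of_unit_norm (𝕜 := 𝕜) (by positivity) fun x hx => ?_
    obtain ⟨f, hf, hxf⟩ := hnet x hx
    have h1 := norm_le_norm_add_norm_sub' (T x) (T f)
    have h2 := hdiff x f hxf
    have h3 := (hval f hf).2
    change ‖T x‖ ≤ _
    linarith
  have hop' : ‖T'‖ ≤ g * 9.02 := by linarith
  have hunit : ∀ x : X, ‖x‖ = 1 → g * 0.98 ≤ ‖T x‖ := by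
    intro x hx
    obtain ⟨f, hf, hxf⟩ := hnet x hx
    have h1 := norm_le_norm_add_norm_sub' (T f) (T x)
    have h2 := hdiff x f hxf
    rw [norm_sub_rev] at h2
    have h3 := (hval f hf).1
    linarith
  refine ⟨(((g * 0.98)⁻¹ : ℝ) : 𝕜) • T, fun x => ?_⟩
  have hc : 0 < (g * 0.98)⁻¹ := by positivity
  rw [LinearMap.smul_apply, norm_smul, RCLike.norm_ofReal, abs_of_pos hc]
  constructor
  · rcases eq_or_ne x 0 with rfl | hx
    · simp
    have hx' : 0 < ‖x‖ := norm_pos_iff.2 hx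
    have h := hunit (((‖x‖⁻¹ : ℝ) : 𝕜) • x) (by
      rw [norm_smul, RCLike.norm_ofReal, abs_of_pos (by positivity), inv_mul_cancel₀ hx'.ne'])
    rw [map_smul, norm_smul, RCLike.norm_ofReal, abs_of_pos (by positivity), ← div_eq_inv_mul,
      le_div_iff₀ hx'] at h
    rw [← div_eq_inv_mul, le_div_iff₀ (by positivity)]
    linarith
  · have h := T'.le_opNorm x
    change ‖T x‖ ≤ _ at h
    rw [← div_eq_inv_mul, div_le_iff₀ (by positivity)]
    nlinarith [norm_nonneg x]

theorem one_le_toReal_of_ne_top (hp : p ≠ ∞) : 1 ≤ p.toReal := by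
  simpa using ENNReal.toReal_mono hp (Fact.out : 1 ≤ p)

theorem norm_toLp_eq_powSum (hp : p ≠ ∞) {n : ℕ} (x : PiLp p (fun _ : Fin n => 𝕜)) :
    ‖x‖ = powSum p.toReal (List.ofFn x) ^ (1 / p.toReal) := by
  have h1 : 0 < p.toReal := ENNReal.toReal_pos (zero_lt_one.trans_le Fact.out).ne' hp
  rw [PiLp.norm_eq_sum h1, powSum, List.map_ofFn, List.sum_ofFn]
  rfl

/-- The stabilisation of the constant for finite `p`. -/
theorem HasCopies.improve_of_ne_top (hp : p ≠ ∞) {C : ℝ} (h : HasCopies 𝕜 p C Y) :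
    HasCopies 𝕜 p 10 Y := by
  have hP := one_le_toReal_of_ne_top hp
  have hP0 : 0 < p.toReal := by linarith
  choose T hT using h
  obtain ⟨G, hG⟩ := exists_spreadingNorm (𝕜 := 𝕜) (Y := Y) (C := C) hP
    (fun n i => if hi : i < n then T n (PiLp.single p ⟨i, hi⟩ 1) else 0) (by
      intro n v hv
      have h1 : Finsupp.linearCombination 𝕜
          (fun i => if hi : i < n then T n (PiLp.single p ⟨i, hi⟩ 1) else 0) v =
          T n (WithLp.toLp p fun i : Fin n => v i) := by
        rw [Finsupp.linearCombination_apply, Finsupp.sum_of_support_subset _ hv _ (by simp),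
          Finset.sum_range]
        have : (WithLp.toLp p fun i : Fin n => v i) =
            ∑ i : Fin n, v i • (PiLp.single p i (1 : 𝕜) : PiLp p (fun _ : Fin n => 𝕜)) := by
          ext j
          simp [Finset.sum_apply, Pi.single_apply]
        rw [this, map_sum]
        simp
      have h2 : ‖(WithLp.toLp p fun i : Fin n => v i)‖ =
          (v.sum fun _ c => ‖c‖ ^ p.toReal) ^ (1 / p.toReal) := by
        rw [PiLp.norm_eq_sum hP0, Finsupp.sum_of_support_subset _ hv _
          (by simp [Real.zero_rpow hP0.ne']), Finset.sum_range]
      rw [h1, ← h2]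
      exact hT n _)
  obtain ⟨G', hG', g, hg, hb⟩ := hG.exists_absolute hP
  intro n
  refine exists_linearMap_of_finset_approx (N := fun x => G' (List.ofFn x)) hg (fun x hx => ?_)
    fun F ε hε => ?_
  · apply hb
    rw [norm_toLp_eq_powSum hp] at hx
    have := congrArg (fun t : ℝ => t ^ p.toReal) hx
    simpa only [Real.one_rpow, ← Real.rpow_mul (powSum_nonneg _),
      one_div_mul_cancel hP0.ne', Real.rpow_one] using this
  · classical
    obtain ⟨y, hy⟩ := hG'.rep (F.image fun x : PiLp p (fun _ : Fin n => 𝕜) => List.ofFn x) ε hε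
    refine ⟨∑ i : Fin n,
      ((PiLp.proj p (fun _ : Fin n => 𝕜) i : PiLp p (fun _ : Fin n => 𝕜) →L[𝕜] 𝕜) :
      PiLp p (fun _ : Fin n => 𝕜) →ₗ[𝕜] 𝕜).smulRight (y i),
      fun x hx => ?_⟩
    have := hy _ (Finset.mem_image_of_mem _ hx)
    rw [wordComb_ofFn] at this
    simpa using this

end

section

variable {𝕜 : Type*} [RCLike 𝕜] {p : ℝ≥0∞} [Fact (1 ≤ p)]
    {Y : Type*} [NormedAddCommGroup Y] [NormedSpace 𝕜 Y]

/-- The norm of a vector in an `ℓ_p`-sum depends only on the norms of its coordinates. -/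
theorem PiLp.norm_eq_of_norm_apply_eq {ι : Type*} [Fintype ι] {α β : ι → Type*}
    [∀ i, SeminormedAddCommGroup (α i)] [∀ i, SeminormedAddCommGroup (β i)]
    (x : PiLp p α) (y : PiLp p β) (h : ∀ i, ‖x i‖ = ‖y i‖) : ‖x‖ = ‖y‖ := by
  rcases p.dichotomy with (rfl | hp)
  · simp_rw [PiLp.norm_eq_ciSup, h]
  · have hp' : 0 < p.toReal := by linarith
    simp_rw [PiLp.norm_eq_sum hp', h]

/-- `ℓ_p^{mn}` is the `ℓ_p`-sum of `m` blocks `ℓ_p^n`. -/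
noncomputable def blockEquiv (𝕜 : Type*) [RCLike 𝕜] (p : ℝ≥0∞) [Fact (1 ≤ p)] (m n : ℕ) :
    PiLp p (fun _ : Fin m => PiLp p (fun _ : Fin n => 𝕜)) ≃ₗᵢ[𝕜]
      PiLp p (fun _ : Fin (m * n) => 𝕜) :=
  (LinearIsometryEquiv.piLpCurry 𝕜 p fun (_ : Fin m) (_ : Fin n) => 𝕜).symm.trans
    (LinearIsometryEquiv.piLpCongrLeft p 𝕜 𝕜
      ((Equiv.sigmaEquivProd (Fin m) (Fin n)).trans finProdFinEquiv))

/-- The map `ℓ_p^m → ℓ_p(ℓ_p^n)`, `a ↦ (a_i u_i)_i`. -/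
def blockDiag {m n : ℕ} (u : Fin m → PiLp p (fun _ : Fin n => 𝕜)) :
    PiLp p (fun _ : Fin m => 𝕜) →ₗ[𝕜] PiLp p (fun _ : Fin m => PiLp p (fun _ : Fin n => 𝕜)) where
  toFun a := WithLp.toLp p fun i => a i • u i
  map_add' a b := by ext i j; simp [add_mul]
  map_smul' c a := by ext i j; simp [mul_assoc]

theorem norm_blockDiag {m n : ℕ} {u : Fin m → PiLp p (fun _ : Fin n => 𝕜)}
    (hu : ∀ i, ‖u i‖ = 1) (a : PiLp p (fun _ : Fin m => 𝕜)) : ‖blockDiag u a‖ = ‖a‖ :=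
  PiLp.norm_eq_of_norm_apply_eq _ _ fun i => by simp [blockDiag, norm_smul, hu]

theorem HasCopies.exists_block {D : ℝ} (h : HasCopies 𝕜 p D Y) (m n : ℕ) :
    ∃ T : PiLp p (fun _ : Fin m => PiLp p (fun _ : Fin n => 𝕜)) →ₗ[𝕜] Y,
      ∀ a, ‖a‖ ≤ ‖T a‖ ∧ ‖T a‖ ≤ D * ‖a‖ := by
  obtain ⟨T, hT⟩ := h (m * n)
  refine ⟨T ∘ₗ (blockEquiv 𝕜 p m n).toLinearEquiv.toLinearMap, fun a => ?_⟩
  have := hT (blockEquiv 𝕜 p m n a)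
  rwa [(blockEquiv 𝕜 p m n).norm_map] at this

/-- The stabilisation of the constant for `p = ∞`: if the least possible constant `D₀` is nearly
attained on all the blocks of `ℓ_∞^{mn}`, then vectors of the blocks at which it is nearly
attained span a copy of `ℓ_∞^m` with a better constant. -/
theorem HasCopies.improve_top {C : ℝ} (h : HasCopies 𝕜 ∞ C Y) : HasCopies 𝕜 ∞ 10 Y := by
  set S : Set ℝ := {D | HasCopies 𝕜 ∞ D Y} with hS
  have hSne : S.Nonempty := ⟨C, h⟩
  have hlow : ∀ D ∈ S, 1 ≤ D := by
    intro D hD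
    obtain ⟨T, hT⟩ := hD 1
    have h1 : ‖(PiLp.single ∞ 0 1 : PiLp ∞ (fun _ : Fin 1 => 𝕜))‖ = 1 := by
      rw [PiLp.norm_single, norm_one]
    have := hT (PiLp.single ∞ 0 1)
    rw [h1] at this
    linarith [this.1, this.2]
  have hbdd : BddBelow S := ⟨1, hlow⟩
  set D₀ := sInf S with hD₀
  have hD₀1 : 1 ≤ D₀ := le_csInf hSne hlow
  obtain ⟨D, hDS, hD⟩ := exists_lt_of_csInf_lt hSne (show sInf S < 1.1 * D₀ by
    rw [← hD₀]; linarith)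
  have hD' : 0.9 * D₀ ∉ S := fun hmem => by
    have := csInf_le hbdd hmem
    linarith
  obtain ⟨n, hn⟩ := not_forall.1 hD'
  intro m
  obtain ⟨T, hT⟩ := hDS.exists_block m n
  have hw : ∀ i : Fin m, ∃ w : PiLp ∞ (fun _ : Fin n => 𝕜), ‖w‖ = 1 ∧
      0.9 * D₀ ≤ ‖T (PiLp.single ∞ i w)‖ := by
    intro i
    by_contra! hcon
    apply hn
    refine ⟨{ toFun := fun w => T (PiLp.single ∞ i w), map_add' := ?_, map_smul' := ?_ },
      fun a => ⟨?_, ?_⟩⟩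
    · intro x y
      rw [← map_add]
      congr 1
      ext j k
      rcases eq_or_ne j i with rfl | hj
      · simp
      · simp [hj]
    · intro c x
      rw [RingHom.id_apply, ← map_smul]
      congr 1
      ext j k
      rcases eq_or_ne j i with rfl | hj
      · simp
      · simp [hj]
    · have := (hT (PiLp.single ∞ i a)).1
      rwa [PiLp.norm_single] at this
    · change ‖T (PiLp.single ∞ i a)‖ ≤ _
      rcases eq_or_ne a 0 with rfl | ha
      · have := (hT (PiLp.single ∞ i 0)).2
        rw [PiLp.norm_single, norm_zero, mul_zero] at this
        rwa [norm_zero, mul_zero]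
      have ha' : 0 < ‖a‖ := norm_pos_iff.2 ha
      have h1 := hcon (((‖a‖⁻¹ : ℝ) : 𝕜) • a) (by
        rw [norm_smul, RCLike.norm_ofReal, abs_of_pos (by positivity), inv_mul_cancel₀ ha'.ne'])
      have h2 : (PiLp.single ∞ i (((‖a‖⁻¹ : ℝ) : 𝕜) • a) :
          PiLp ∞ (fun _ : Fin m => PiLp ∞ (fun _ : Fin n => 𝕜))) =
          ((‖a‖⁻¹ : ℝ) : 𝕜) • PiLp.single ∞ i a := by
        ext j k
        rcases eq_or_ne j i with rfl | hj
        · simp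
        · simp [hj]
      rw [h2, map_smul, norm_smul, RCLike.norm_ofReal, abs_of_pos (by positivity),
        inv_mul_lt_iff₀ ha'] at h1
      linarith
  choose w hw1 hw2 using hw
  have hmain : ∀ a : PiLp ∞ (fun _ : Fin m => 𝕜),
      0.7 * D₀ * ‖a‖ ≤ ‖T (blockDiag w a)‖ ∧ ‖T (blockDiag w a)‖ ≤ 1.1 * D₀ * ‖a‖ := by
    have hup : ∀ a : PiLp ∞ (fun _ : Fin m => 𝕜), ‖T (blockDiag w a)‖ ≤ 1.1 * D₀ * ‖a‖ := by
      intro a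
      have := (hT (blockDiag w a)).2
      rw [norm_blockDiag hw1] at this
      exact this.trans (by gcongr)
    refine fun a => ⟨?_, hup a⟩
    rcases isEmpty_or_nonempty (Fin m) with hm | hm
    · have : a = 0 := Subsingleton.elim _ _
      simp [this]
    obtain ⟨i, hi⟩ := exists_eq_ciSup_of_finite (f := fun i => ‖a i‖)
    have hi' : ‖a i‖ = ‖a‖ := by rw [PiLp.norm_eq_ciSup]; exact hi
    -- `a` and the vector `b` with all other signs changed have average `aᵢ eᵢ`
    set b : PiLp ∞ (fun _ : Fin m => 𝕜) := WithLp.toLp ∞ fun j => if j = i then a j else -a j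
    have hb : ‖b‖ = ‖a‖ := PiLp.norm_eq_of_norm_apply_eq _ _ fun j => by
      simp only [b]
      split_ifs <;> simp
    have hsum : T (blockDiag w a) + T (blockDiag w b) = (2 * a i) • T (PiLp.single ∞ i (w i)) := by
      rw [← map_add, ← map_add, ← map_smul]
      congr 1
      ext j k
      rcases eq_or_ne j i with rfl | hj
      · simp [blockDiag, b, two_mul]
      · simp [blockDiag, b, hj]
    have h1 := hup b
    rw [hb] at h1
    have h2 := norm_add_le (T (blockDiag w a)) (T (blockDiag w b))
    rw [hsum, norm_smul, norm_mul, hi', RCLike.norm_two] at h2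
    have h3 := mul_le_mul_of_nonneg_left (hw2 i) (norm_nonneg a)
    linarith
  have hc : 0 < (0.7 * D₀)⁻¹ := by positivity
  refine ⟨(((0.7 * D₀)⁻¹ : ℝ) : 𝕜) • (T ∘ₗ blockDiag w), fun a => ?_⟩
  obtain ⟨h1, h2⟩ := hmain a
  rw [LinearMap.smul_apply, norm_smul, RCLike.norm_ofReal, abs_of_pos hc, LinearMap.comp_apply,
    ← div_eq_inv_mul, le_div_iff₀ (by positivity), div_le_iff₀ (by positivity)]
  constructor
  · linarith
  · nlinarith [norm_nonneg a, mul_nonneg (by linarith : (0 : ℝ) ≤ D₀) (norm_nonneg a)]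

theorem ContainsEllpUniformly.hasCopies (hY : ContainsEllpUniformly 𝕜 p Y) :
    HasCopies 𝕜 p 10 Y := by
  obtain ⟨C, hC⟩ := hY.exists_hasCopies
  rcases eq_or_ne p ∞ with rfl | hp
  · exact hC.improve_top
  · exact hC.improve_of_ne_top hp

/-! ### Copies of `ℓ_p^n` forming a finite-dimensional decomposition -/

/-- Copies of `ℓ_p^n` exist in every subspace of finite codimension: a block of `ℓ_p^{nk}` whose
length `k` exceeds the codimension meets the subspace. -/
theorem HasCopies.exists_mem_ker {D : ℝ} (h : HasCopies 𝕜 p D Y) (W : Finset (Y →L[𝕜] 𝕜))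
    (n : ℕ) : ∃ T : PiLp p (fun _ : Fin n => 𝕜) →ₗ[𝕜] Y,
      (∀ a, ‖a‖ ≤ ‖T a‖ ∧ ‖T a‖ ≤ D * ‖a‖) ∧ ∀ φ ∈ W, ∀ a, φ (T a) = 0 := by
  obtain ⟨T, hT⟩ := h.exists_block n (W.card + 1)
  have hu : ∀ i : Fin n, ∃ u : PiLp p (fun _ : Fin (W.card + 1) => 𝕜), ‖u‖ = 1 ∧
      ∀ φ ∈ W, φ (T (PiLp.single p i u)) = 0 := by
    intro i
    have hlin : ∀ φ : W, ∃ ψ : PiLp p (fun _ : Fin (W.card + 1) => 𝕜) →ₗ[𝕜] 𝕜,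
        ∀ u, ψ u = φ.1 (T (PiLp.single p i u)) := by
      intro φ
      refine ⟨{ toFun := fun w => φ.1 (T (PiLp.single p i w)), map_add' := ?_, map_smul' := ?_ },
        fun _ => rfl⟩
      · intro x y
        rw [← map_add, ← map_add]
        congr 2
        ext j k
        rcases eq_or_ne j i with rfl | hj
        · simp
        · simp [hj]
      · intro c x
        rw [RingHom.id_apply, ← map_smul, ← map_smul]
        congr 2
        ext j k
        rcases eq_or_ne j i with rfl | hj
        · simp
        · simp [hj]
    choose ψ hψ using hlin
    have hker : (LinearMap.pi ψ).ker ≠ ⊥ := by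
      apply LinearMap.ker_ne_bot_of_finrank_lt
      rw [LinearEquiv.finrank_eq (WithLp.linearEquiv p 𝕜 (Fin (W.card + 1) → 𝕜))]
      simp
    obtain ⟨v, hv, hv0⟩ := (Submodule.ne_bot_iff _).1 hker
    have hv' : 0 < ‖v‖ := norm_pos_iff.2 hv0
    refine ⟨((‖v‖⁻¹ : ℝ) : 𝕜) • v, by
      rw [norm_smul, RCLike.norm_ofReal, abs_of_pos (by positivity), inv_mul_cancel₀ hv'.ne'],
      fun φ hφ => ?_⟩
    have h1 := congrFun (LinearMap.mem_ker.1 hv) ⟨φ, hφ⟩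
    rw [← hψ ⟨φ, hφ⟩, map_smul]
    simp only [LinearMap.pi_apply, Pi.zero_apply] at h1
    rw [h1, smul_zero]
  choose u hu1 hu2 using hu
  refine ⟨T ∘ₗ blockDiag u, fun a => ?_, fun φ hφ a => ?_⟩
  · have := hT (blockDiag u a)
    rwa [norm_blockDiag hu1] at this
  · have : blockDiag u a = ∑ i, a i • (PiLp.single p i (u i) :
        PiLp p (fun _ : Fin n => PiLp p (fun _ : Fin (W.card + 1) => 𝕜))) := by
      ext j k
      simp [blockDiag, Finset.sum_apply, Pi.single_apply, apply_ite]
    rw [LinearMap.comp_apply, this, map_sum, map_sum]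
    refine Finset.sum_eq_zero fun i _ => ?_
    rw [map_smul, map_smul, hu2 i φ hφ, smul_zero]

/-- A finite-dimensional subspace is normed, up to a factor `1.1`, by finitely many functionals
of norm at most one. -/
theorem exists_finset_norming (E : Submodule 𝕜 Y) [FiniteDimensional 𝕜 E] :
    ∃ W : Finset (Y →L[𝕜] 𝕜), (∀ φ ∈ W, ‖φ‖ ≤ 1) ∧
      ∀ e ∈ E, e ≠ 0 → ∃ φ ∈ W, ‖e‖ ≤ 1.1 * ‖φ e‖ := by
  classical
  have : ProperSpace E := FiniteDimensional.proper_rclike 𝕜 E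
  have hdual : ∀ e : E, ∃ φ : Y →L[𝕜] 𝕜, ‖φ‖ ≤ 1 ∧ φ (e : Y) = ‖(e : Y)‖ := by
    intro e
    exact exists_dual_vector'' 𝕜 (e : Y)
  choose φ hφ1 hφ2 using hdual
  obtain ⟨F, -, hFfin, hF⟩ := (isCompact_sphere (0 : E) 1).elim_finite_subcover_image
    (b := Metric.sphere (0 : E) 1) (c := fun e => {x : E | 1 / 1.1 < ‖φ e (x : Y)‖})
    (fun e _ => isOpen_lt continuous_const (by fun_prop)) (fun e he => by
      refine Set.mem_iUnion₂.2 ⟨e, he, ?_⟩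
      have : ‖(e : Y)‖ = 1 := by simpa using he
      simp only [Set.mem_ofPred_eq, hφ2, this]
      norm_num)
  refine ⟨hFfin.toFinset.image φ, fun ψ hψ => ?_, fun e he he0 => ?_⟩
  · obtain ⟨e, -, rfl⟩ := Finset.mem_image.1 hψ
    exact hφ1 e
  · have he' : 0 < ‖e‖ := norm_pos_iff.2 he0
    obtain ⟨f, hf, hx⟩ := Set.mem_iUnion₂.1 (hF (show ((‖e‖⁻¹ : ℝ) : 𝕜) • (⟨e, he⟩ : E) ∈
      Metric.sphere (0 : E) 1 by
        rw [mem_sphere_zero_iff_norm, norm_smul, RCLike.norm_ofReal, abs_of_pos (by positivity)]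
        exact inv_mul_cancel₀ he'.ne'))
    refine ⟨φ f, Finset.mem_image_of_mem _ (hFfin.mem_toFinset.2 hf), ?_⟩
    simp only [Set.mem_ofPred_eq, Submodule.coe_smul, map_smul, norm_smul, RCLike.norm_ofReal] at hx
    rw [abs_of_pos (by positivity), ← div_eq_inv_mul, lt_div_iff₀ he'] at hx
    linarith

/-- The data of the recursive construction of a finite-dimensional decomposition: the span of the
blocks chosen so far and the functionals on which the later blocks have to vanish. -/
structure BlockStage (𝕜 : Type*) [RCLike 𝕜] (Y : Type*) [NormedAddCommGroup Y]
    [NormedSpace 𝕜 Y] where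
  /-- the span of the blocks chosen so far -/
  span : Submodule 𝕜 Y
  finDim : FiniteDimensional 𝕜 span
  /-- the functionals on which the later blocks vanish -/
  functionals : Finset (Y →L[𝕜] 𝕜)

/-- Copies `T j` of `ℓ_p^{d j}` can be chosen so that each of them is complemented in the closed
span of all of them, by coordinate projections of norm at most `2.2`. -/
theorem HasCopies.exists_decomposition {D : ℝ} (h : HasCopies 𝕜 p D Y) (d : ℕ → ℕ) :
    ∃ T : ∀ j, PiLp p (fun _ : Fin (d j) => 𝕜) →ₗ[𝕜] Y,
      (∀ j a, ‖a‖ ≤ ‖T j a‖ ∧ ‖T j a‖ ≤ D * ‖a‖) ∧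
      ∀ (a : ∀ j, PiLp p (fun _ : Fin (d j) => 𝕜)) (y : Y), HasSum (fun j => T j (a j)) y →
        ∀ j, ‖T j (a j)‖ ≤ 2.2 * ‖y‖ := by
  classical
  choose T₀ hT₀ hker using fun (W : Finset (Y →L[𝕜] 𝕜)) n => h.exists_mem_ker W n
  choose W₀ hW₀ hnorm using fun s : BlockStage 𝕜 Y =>
    haveI := s.finDim
    exists_finset_norming s.span
  let stage : ℕ → BlockStage 𝕜 Y := fun k => Nat.rec ⟨⊥, inferInstance, ∅⟩
    (fun j s => ⟨s.span ⊔ (T₀ (W₀ s ∪ s.functionals) (d j)).range,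
      haveI := s.finDim
      inferInstance, W₀ s ∪ s.functionals⟩) k
  let T : ∀ j, PiLp p (fun _ : Fin (d j) => 𝕜) →ₗ[𝕜] Y := fun j =>
    T₀ (W₀ (stage j) ∪ (stage j).functionals) (d j)
  have hspan : ∀ j, (stage (j + 1)).span = (stage j).span ⊔ (T j).range := fun j => rfl
  have hfun : ∀ j, (stage (j + 1)).functionals = W₀ (stage j) ∪ (stage j).functionals :=
    fun j => rfl
  have hmono : ∀ i j, i ≤ j → W₀ (stage i) ⊆ W₀ (stage j) ∪ (stage j).functionals := by
    intro i j hij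
    induction j, hij using Nat.le_induction with
    | base => exact Finset.subset_union_left
    | succ j _ ih => exact (ih.trans (hfun j).symm.subset).trans Finset.subset_union_right
  have hmem : ∀ (a : ∀ j, PiLp p (fun _ : Fin (d j) => 𝕜)) k,
      ∑ i ∈ Finset.range k, T i (a i) ∈ (stage k).span := by
    intro a k
    induction k with
    | zero => simp
    | succ k ih =>
      rw [Finset.sum_range_succ, hspan]
      exact add_mem (Submodule.mem_sup_left ih) (Submodule.mem_sup_right ⟨_, rfl⟩)
  refine ⟨T, fun j => hT₀ _ _, fun a y hy j => ?_⟩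
  -- the functionals norming the first `k` blocks vanish on the later ones
  have hpart : ∀ k, ‖∑ i ∈ Finset.range k, T i (a i)‖ ≤ 1.1 * ‖y‖ := by
    intro k
    rcases eq_or_ne (∑ i ∈ Finset.range k, T i (a i)) 0 with h0 | h0
    · rw [h0, norm_zero]; positivity
    obtain ⟨φ, hφ, hle⟩ := hnorm (stage k) _ (hmem a k) h0
    have h1 : φ (∑ i ∈ Finset.range k, T i (a i)) = φ y := by
      have h2 : HasSum (fun i => φ (T i (a i))) (φ y) := hy.mapL φ
      refine HasSum.unique ?_ h2
      rw [map_sum]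
      refine hasSum_sum_of_ne_finset_zero fun i hi => ?_
      exact hker _ _ φ (hmono k i (by simpa using hi) hφ) _
    rw [h1] at hle
    refine hle.trans ?_
    have := φ.le_opNorm y
    have h3 := hW₀ _ φ hφ
    nlinarith [norm_nonneg y]
  have h1 := hpart j
  have h2 := hpart (j + 1)
  have h3 : T j (a j) =
      ∑ i ∈ Finset.range (j + 1), T i (a i) - ∑ i ∈ Finset.range j, T i (a i) := by
    rw [Finset.sum_range_succ]; abel
  rw [h3]
  refine (norm_sub_le _ _).trans ?_
  linarith

end

/-! ### Approximation of compact subsets of `L_p` by maps into `ℓ_p^n` -/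

section

variable {𝕜 : Type*} [RCLike 𝕜] {p : ℝ≥0∞} {Ω : Type*} [MeasurableSpace Ω] {ν : Measure Ω}

/-- Jensen's inequality for the average over a set of finite measure. -/
theorem measureReal_mul_norm_setAverage_rpow_le [Fact (1 ≤ p)] (hp : p ≠ ∞) {f : Ω → 𝕜}
    (hf : MemLp f p ν) {A : Set Ω} (hA : ν A ≠ ∞) :
    ν.real A * ‖⨍ x in A, f x ∂ν‖ ^ p.toReal ≤ ∫ x in A, ‖f x‖ ^ p.toReal ∂ν := by
  have hP := one_le_toReal_of_ne_top hp
  have hp0 : p ≠ 0 := (zero_lt_one.trans_le Fact.out).ne'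
  rcases eq_or_ne (ν A) 0 with h0 | h0
  · have : ν.restrict A = 0 := by simpa using h0
    simp [Measure.real, h0, this]
  have hfin : IsFiniteMeasure (ν.restrict A) := ⟨by simpa using hA.lt_top⟩
  have hne : NeZero (ν.restrict A) := ⟨by simpa using h0⟩
  have hfA := hf.restrict A
  have hint : Integrable f (ν.restrict A) := hfA.integrable Fact.out
  have hJ : (⨍ x in A, ‖f x‖ ∂ν) ^ p.toReal ≤ ⨍ x in A, ‖f x‖ ^ p.toReal ∂ν :=
    (convexOn_rpow hP).map_average_le (continuousOn_id.rpow_const fun x _ => Or.inr (by linarith))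
      isClosed_Ici (Eventually.of_forall fun x => norm_nonneg _) hint.norm
      (hfA.integrable_norm_rpow hp0 hp)
  have hm : 0 < ν.real A := ENNReal.toReal_pos h0 hA
  have hn : ‖⨍ x in A, f x ∂ν‖ ≤ ⨍ x in A, ‖f x‖ ∂ν := by
    rw [setAverage_eq, setAverage_eq, norm_smul, smul_eq_mul, Real.norm_eq_abs,
      abs_of_pos (by positivity)]
    gcongr
    exact norm_integral_le_integral_norm _
  calc ν.real A * ‖⨍ x in A, f x ∂ν‖ ^ p.toReal
      ≤ ν.real A * ⨍ x in A, ‖f x‖ ^ p.toReal ∂ν := by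
        gcongr
        exact (Real.rpow_le_rpow (norm_nonneg _) hn (by linarith)).trans hJ
    _ = ∫ x in A, ‖f x‖ ^ p.toReal ∂ν := by
        rw [setAverage_eq, smul_eq_mul, mul_inv_cancel_left₀ hm.ne']

theorem Lp.norm_rpow_eq_integral [Fact (1 ≤ p)] (hp : p ≠ ∞) (f : Lp 𝕜 p ν) :
    ‖f‖ ^ p.toReal = ∫ x, ‖f x‖ ^ p.toReal ∂ν := by
  have hP := one_le_toReal_of_ne_top hp
  have hp0 : p ≠ 0 := (zero_lt_one.trans_le Fact.out).ne'
  have hnn : 0 ≤ ∫ x, ‖f x‖ ^ p.toReal ∂ν := integral_nonneg fun x => by positivity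
  rw [Lp.norm_def, (Lp.memLp f).eLpNorm_eq_integral_rpow_norm hp0 hp,
    ENNReal.toReal_ofReal (by positivity), ← Real.rpow_mul hnn,
    inv_mul_cancel₀ (by linarith), Real.rpow_one]

/-- The averages of `f ∈ L_p` over the sets `A c`, normalised so that the map is isometric on
functions that are constant on the sets `A c` and vanish off their union. -/
noncomputable def cellAverages {ι : Type*} (A : ι → Set Ω) (f : Lp 𝕜 p ν) :
    PiLp p (fun _ : ι => 𝕜) :=
  WithLp.toLp p fun c => ((ν.real (A c) ^ (1 / p.toReal) : ℝ) : 𝕜) * ⨍ x in A c, f x ∂ν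

theorem norm_cellAverages_apply_rpow [Fact (1 ≤ p)] (hp : p ≠ ∞) {ι : Type*} (A : ι → Set Ω)
    (f : Lp 𝕜 p ν) (c : ι) : ‖cellAverages A f c‖ ^ p.toReal =
      ν.real (A c) * ‖⨍ x in A c, f x ∂ν‖ ^ p.toReal := by
  have hP := one_le_toReal_of_ne_top hp
  have h0 : (0 : ℝ) ≤ ν.real (A c) := ENNReal.toReal_nonneg
  simp only [cellAverages, norm_mul, RCLike.norm_ofReal]
  rw [abs_of_nonneg (by positivity), Real.mul_rpow (by positivity) (norm_nonneg _),
    ← Real.rpow_mul h0, one_div_mul_cancel (by linarith), Real.rpow_one]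

theorem cellAverages_sub [Fact (1 ≤ p)] {ι : Type*} {A : ι → Set Ω} (hA : ∀ c, ν (A c) ≠ ∞)
    (f g : Lp 𝕜 p ν) : cellAverages A (f - g) = cellAverages A f - cellAverages A g := by
  ext c
  have hfin : IsFiniteMeasure (ν.restrict (A c)) := ⟨by simpa using (hA c).lt_top⟩
  have hint : ∀ f : Lp 𝕜 p ν, Integrable f (ν.restrict (A c)) := fun f =>
    ((Lp.memLp f).restrict (A c)).integrable Fact.out
  have h1 : ∫ x in A c, (f - g : Lp 𝕜 p ν) x ∂ν = ∫ x in A c, f x ∂ν - ∫ x in A c, g x ∂ν := by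
    rw [← integral_sub (hint f) (hint g)]
    exact integral_congr_ae (ae_restrict_of_ae (Lp.coeFn_sub f g))
  simp only [cellAverages, PiLp.sub_apply, setAverage_eq, h1, smul_sub, mul_sub]

theorem norm_cellAverages_le [Fact (1 ≤ p)] (hp : p ≠ ∞) {ι : Type*} [Fintype ι]
    {A : ι → Set Ω} (hA : ∀ c, ν (A c) ≠ ∞) (hmeas : ∀ c, MeasurableSet (A c))
    (hdisj : Pairwise (Function.onFun Disjoint A)) (f : Lp 𝕜 p ν) :
    ‖cellAverages A f‖ ≤ ‖f‖ := by
  have hP := one_le_toReal_of_ne_top hp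
  have hp0 : p ≠ 0 := (zero_lt_one.trans_le Fact.out).ne'
  have hint := (Lp.memLp f).integrable_norm_rpow hp0 hp
  rw [PiLp.norm_eq_sum (by linarith), ← Real.rpow_le_rpow_iff (by positivity) (norm_nonneg _)
    (by linarith : 0 < p.toReal), ← Real.rpow_mul (by positivity),
    one_div_mul_cancel (by linarith), Real.rpow_one, Lp.norm_rpow_eq_integral hp]
  calc ∑ c, ‖cellAverages A f c‖ ^ p.toReal ≤ ∑ c, ∫ x in A c, ‖f x‖ ^ p.toReal ∂ν := by
        refine Finset.sum_le_sum fun c _ => ?_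
        rw [norm_cellAverages_apply_rpow hp]
        exact measureReal_mul_norm_setAverage_rpow_le hp (Lp.memLp f) (hA c)
    _ = ∫ x in ⋃ c ∈ (Finset.univ : Finset ι), A c, ‖f x‖ ^ p.toReal ∂ν :=
        (integral_biUnion_finset _ (fun c _ => hmeas c) (fun c _ d _ h => hdisj h)
          fun c _ => hint.integrableOn).symm
    _ ≤ ∫ x, ‖f x‖ ^ p.toReal ∂ν :=
        setIntegral_le_integral hint (Eventually.of_forall fun x => by positivity)

theorem norm_cellAverages_eq [Fact (1 ≤ p)] (hp : p ≠ ∞) {ι : Type*} [Fintype ι]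
    {A : ι → Set Ω} (hA : ∀ c, ν (A c) ≠ ∞) (hmeas : ∀ c, MeasurableSet (A c))
    (hdisj : Pairwise (Function.onFun Disjoint A)) (f : Lp 𝕜 p ν) (s : Ω → 𝕜) (hs : f =ᵐ[ν] s)
    (v : ι → 𝕜) (hconst : ∀ c, ∀ x ∈ A c, s x = v c) (hoff : ∀ x, (∀ c, x ∉ A c) → s x = 0) :
    ‖cellAverages A f‖ = ‖f‖ := by
  have hP := one_le_toReal_of_ne_top hp
  have hp0 : p ≠ 0 := (zero_lt_one.trans_le Fact.out).ne'
  have hint : Integrable (fun x => ‖s x‖ ^ p.toReal) ν :=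
    ((memLp_congr_ae hs).1 (Lp.memLp f)).integrable_norm_rpow hp0 hp
  refine (Real.rpow_left_inj (norm_nonneg _) (norm_nonneg _)
    (by linarith : p.toReal ≠ 0)).1 ?_
  rw [PiLp.norm_eq_sum (by linarith), ← Real.rpow_mul (by positivity),
    one_div_mul_cancel (by linarith), Real.rpow_one, Lp.norm_rpow_eq_integral hp]
  have hcell : ∀ c, ∫ x in A c, ‖s x‖ ^ p.toReal ∂ν = ν.real (A c) * ‖v c‖ ^ p.toReal := by
    intro c
    rw [setIntegral_congr_fun (g := fun _ => ‖v c‖ ^ p.toReal) (hmeas c) fun x hx => by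
      simp only [hconst c x hx]]
    simp
  calc ∑ c, ‖cellAverages A f c‖ ^ p.toReal = ∑ c, ∫ x in A c, ‖s x‖ ^ p.toReal ∂ν := by
        refine Finset.sum_congr rfl fun c _ => ?_
        rw [norm_cellAverages_apply_rpow hp, hcell]
        rcases eq_or_ne (ν (A c)) 0 with h0 | h0
        · simp [Measure.real, h0]
        · have hm : ν.real (A c) ≠ 0 := (ENNReal.toReal_pos h0 (hA c)).ne'
          have : ⨍ x in A c, f x ∂ν = v c := by
            rw [setAverage_eq, integral_congr_ae (ae_restrict_of_ae hs),
              setIntegral_congr_fun (g := fun _ => v c) (hmeas c) fun x hx => hconst c x hx]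
            rw [setIntegral_const, smul_smul, inv_mul_cancel₀ hm, one_smul]
          rw [this]
    _ = ∫ x in ⋃ c ∈ (Finset.univ : Finset ι), A c, ‖s x‖ ^ p.toReal ∂ν :=
        (integral_biUnion_finset _ (fun c _ => hmeas c) (fun c _ d _ h => hdisj h)
          fun c _ => hint.integrableOn).symm
    _ = ∫ x, ‖s x‖ ^ p.toReal ∂ν := by
        refine setIntegral_eq_integral_of_forall_compl_eq_zero fun x hx => ?_
        rw [hoff x fun c hc => hx (Set.mem_iUnion₂.2 ⟨c, Finset.mem_univ _, hc⟩), norm_zero,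
          Real.zero_rpow (by linarith)]
    _ = ∫ x, ‖f x‖ ^ p.toReal ∂ν := by
        refine integral_congr_ae ?_
        filter_upwards [hs] with x hx
        rw [hx]

/-- Finitely many simple functions lie isometrically in some `ℓ_p^n`, by the restriction of a
`1`-Lipschitz map. -/
theorem exists_lipschitz_isometry_on_simpleFunc [Fact (1 ≤ p)] (hp : p ≠ ∞) {κ : Type*} [Finite κ]
    (s : κ → Lp.simpleFunc 𝕜 p ν) :
    ∃ (n : ℕ) (φ : Lp 𝕜 p ν → PiLp p (fun _ : Fin n => 𝕜)), (∀ f g, ‖φ f - φ g‖ ≤ ‖f - g‖) ∧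
      ∀ i j, ‖φ (s i) - φ (s j)‖ = ‖(s i : Lp 𝕜 p ν) - s j‖ := by
  have hp0 : p ≠ 0 := (zero_lt_one.trans_le Fact.out).ne'
  set g : Ω → κ → 𝕜 := fun x i => Lp.simpleFunc.toSimpleFunc (s i) x with hg
  have hfin : (Set.range g \ {0}).Finite := by
    refine Set.Finite.subset (Set.Finite.pi' fun i =>
      (Lp.simpleFunc.toSimpleFunc (s i)).finite_range) ?_
    rintro _ ⟨⟨x, rfl⟩, -⟩ i
    exact ⟨x, rfl⟩
  have : Fintype ↥(Set.range g \ {0}) := hfin.fintype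
  set e := Fintype.equivFin ↥(Set.range g \ {0}) with he
  set A : Fin (Fintype.card ↥(Set.range g \ {0})) → Set Ω := fun c => g ⁻¹' {(e.symm c).1}
    with hAdef
  have hA : ∀ c, ν (A c) ≠ ∞ := by
    intro c
    obtain ⟨i, hi⟩ := Function.ne_iff.1 (e.symm c).2.2
    refine (lt_of_le_of_lt (measure_mono ?_) (SimpleFunc.measure_preimage_lt_top_of_memLp hp0 hp _
      (Lp.simpleFunc.memLp (s i)) _ hi)).ne
    intro x hx
    exact congrFun hx i
  have hmeas : ∀ c, MeasurableSet (A c) := by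
    intro c
    have : A c = ⋂ i, (Lp.simpleFunc.toSimpleFunc (s i)) ⁻¹' {(e.symm c).1 i} := by
      ext x
      simp [hAdef, hg, funext_iff]
    rw [this]
    exact MeasurableSet.iInter fun i => SimpleFunc.measurableSet_preimage _ _
  have hdisj : Pairwise (Function.onFun Disjoint A) := by
    intro c d hcd
    refine Set.disjoint_left.2 fun x hx hx' => hcd ?_
    exact e.symm.injective (Subtype.ext (hx.symm.trans hx'))
  refine ⟨_, cellAverages A, fun f h => ?_, fun i j => ?_⟩
  · rw [← cellAverages_sub hA]
    exact norm_cellAverages_le hp hA hmeas hdisj _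
  · rw [← cellAverages_sub hA]
    refine norm_cellAverages_eq hp hA hmeas hdisj _ (fun x => g x i - g x j) ?_
      (fun c => (e.symm c).1 i - (e.symm c).1 j) ?_ ?_
    · filter_upwards [Lp.coeFn_sub (s i : Lp 𝕜 p ν) (s j),
        Lp.simpleFunc.toSimpleFunc_eq_toFun (s i),
        Lp.simpleFunc.toSimpleFunc_eq_toFun (s j)] with x h1 h2 h3
      rw [h1, Pi.sub_apply, ← h2, ← h3]
    · intro c x hx
      have hx' : g x = (e.symm c).1 := hx
      simp only [hx']
    · intro x hx
      have : g x = 0 := by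
        by_contra h0
        refine hx (e ⟨g x, ⟨x, rfl⟩, h0⟩) ?_
        simp [hAdef]
      simp [this]

/-- A compact subset of `L_p` embeds into some `ℓ_p^n` up to an additive error `η`, by the
restriction of a `1`-Lipschitz map. For `p = ∞` this map is Fréchet's embedding, for `p < ∞` it
consists of averages over the cells of a partition. -/
theorem exists_lipschitz_approx [Fact (1 ≤ p)] {K : Set (Lp 𝕜 p ν)} (hK : IsCompact K) {η : ℝ}
    (hη : 0 < η) (t₀ : Lp 𝕜 p ν) :
    ∃ (n : ℕ) (φ : Lp 𝕜 p ν → PiLp p (fun _ : Fin n => 𝕜)), (∀ f g, ‖φ f - φ g‖ ≤ ‖f - g‖) ∧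
      φ t₀ = 0 ∧ ∀ f ∈ K, ∀ g ∈ K, ‖f - g‖ - η ≤ ‖φ f - φ g‖ := by
  suffices h : ∃ (n : ℕ) (φ : Lp 𝕜 p ν → PiLp p (fun _ : Fin n => 𝕜)),
      (∀ f g, ‖φ f - φ g‖ ≤ ‖f - g‖) ∧ ∀ f ∈ K, ∀ g ∈ K, ‖f - g‖ - η ≤ ‖φ f - φ g‖ by
    obtain ⟨n, φ, h1, h2⟩ := h
    exact ⟨n, fun f => φ f - φ t₀, by simpa using h1, sub_self _, by simpa using h2⟩
  obtain ⟨t, -, htfin, ht⟩ := hK.finite_cover_balls (show 0 < η / 8 by positivity)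
  have : Fintype t := htfin.fintype
  have hnear : ∀ f ∈ K, ∃ z : t, ‖f - z‖ ≤ η / 8 := by
    intro f hf
    obtain ⟨z, hz, hfz⟩ := Set.mem_iUnion₂.1 (ht hf)
    exact ⟨⟨z, hz⟩, by rw [← dist_eq_norm]; exact (Metric.mem_ball.1 hfz).le⟩
  rcases eq_or_ne p ∞ with rfl | hp
  · set e := Fintype.equivFin t
    set φ : Lp 𝕜 ∞ ν → PiLp ∞ (fun _ : Fin (Fintype.card t) => 𝕜) :=
      fun f => WithLp.toLp ∞ fun i => ((‖f - (e.symm i : Lp 𝕜 ∞ ν)‖ : ℝ) : 𝕜) with hφ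
    have hcoord : ∀ f g i, ‖(φ f - φ g) i‖ =
        |‖f - (e.symm i : Lp 𝕜 ∞ ν)‖ - ‖g - (e.symm i : Lp 𝕜 ∞ ν)‖| := by
      intro f g i
      simp only [hφ, PiLp.sub_apply]
      rw [← RCLike.ofReal_sub, RCLike.norm_ofReal]
    refine ⟨_, φ, fun f g => ?_, fun f _ g hg => ?_⟩
    · rw [PiLp.norm_eq_ciSup]
      refine Real.iSup_le (fun i => ?_) (norm_nonneg _)
      rw [hcoord]
      refine (abs_norm_sub_norm_le _ _).trans ?_
      rw [sub_sub_sub_cancel_right]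
    · obtain ⟨z, hz⟩ := hnear g hg
      have h1 := PiLp.norm_apply_le (φ f - φ g) (e z)
      rw [hcoord, e.symm_apply_apply] at h1
      have h2 := norm_sub_le_norm_sub_add_norm_sub f (z : Lp 𝕜 ∞ ν) g
      rw [norm_sub_rev (z : Lp 𝕜 ∞ ν) g] at h2
      have h3 := le_abs_self (‖f - (z : Lp 𝕜 ∞ ν)‖ - ‖g - (z : Lp 𝕜 ∞ ν)‖)
      linarith
  · have hs : ∀ z : t, ∃ s : Lp.simpleFunc 𝕜 p ν, ‖(z : Lp 𝕜 p ν) - s‖ < η / 8 := by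
      intro z
      obtain ⟨s, hs⟩ := (Lp.simpleFunc.denseRange hp).exists_dist_lt (z : Lp 𝕜 p ν)
        (show 0 < η / 8 by positivity)
      exact ⟨s, by rwa [dist_eq_norm] at hs⟩
    choose s hs using hs
    obtain ⟨n, φ, h1, h2⟩ := exists_lipschitz_isometry_on_simpleFunc hp s
    refine ⟨n, φ, h1, fun f hf g hg => ?_⟩
    have hnear' : ∀ f ∈ K, ∃ z : t, ‖f - s z‖ ≤ η / 4 := by
      intro f hf
      obtain ⟨z, hz⟩ := hnear f hf
      refine ⟨z, (norm_sub_le_norm_sub_add_norm_sub f (z : Lp 𝕜 p ν) (s z)).trans ?_⟩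
      linarith [hs z]
    obtain ⟨y, hy⟩ := hnear' f hf
    obtain ⟨z, hz⟩ := hnear' g hg
    have e1 := h2 y z
    have e2 := h1 f (s y)
    have e3 := h1 g (s z)
    have e4 : ‖φ (s y) - φ (s z)‖ ≤ ‖φ f - φ (s y)‖ + ‖φ f - φ g‖ + ‖φ g - φ (s z)‖ := by
      have : φ (s y) - φ (s z) = -(φ f - φ (s y)) + (φ f - φ g) + (φ g - φ (s z)) := by abel
      rw [this]
      refine (norm_add₃_le).trans ?_
      rw [norm_neg]
    have e5 : ‖f - g‖ ≤ ‖f - s y‖ + ‖(s y : Lp 𝕜 p ν) - s z‖ + ‖g - s z‖ := by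
      have : f - g = (f - s y) + ((s y : Lp 𝕜 p ν) - s z) + -(g - s z) := by abel
      rw [this]
      refine (norm_add₃_le).trans ?_
      rw [norm_neg]
    linarith

end

/-! ### Gluing along a logarithmic partition of unity -/

/-- The piecewise linear hat function centred at `n`. -/
noncomputable def hat (n : ℕ) (u : ℝ) : ℝ := max 0 (1 - |u - n|)

theorem hat_nonneg (n : ℕ) (u : ℝ) : 0 ≤ hat n u := le_max_left _ _

theorem abs_hat_sub_le (n : ℕ) (u v : ℝ) : |hat n u - hat n v| ≤ |u - v| := by
  refine (abs_max_sub_max_le_max _ _ _ _).trans (max_le (by simp) ?_)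
  rw [sub_sub_sub_cancel_left, abs_sub_comm u v]
  refine (abs_abs_sub_abs_le_abs_sub _ _).trans ?_
  rw [sub_sub_sub_cancel_right]

theorem hat_floor {u : ℝ} (hu : 0 ≤ u) : hat ⌊u⌋₊ u = 1 - (u - ⌊u⌋₊) := by
  have h1 := Nat.floor_le hu
  have h2 := Nat.lt_floor_add_one u
  rw [hat, abs_of_nonneg (by linarith), max_eq_right (by linarith)]

theorem hat_floor_succ {u : ℝ} (hu : 0 ≤ u) : hat (⌊u⌋₊ + 1) u = u - ⌊u⌋₊ := by
  have h1 := Nat.floor_le hu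
  have h2 := Nat.lt_floor_add_one u
  rw [hat, abs_of_nonpos (by push_cast; linarith)]
  push_cast
  rw [max_eq_right (by linarith)]
  ring

theorem hat_eq_zero {u : ℝ} (hu : 0 ≤ u) {n : ℕ} (hn : n ∉ ({⌊u⌋₊, ⌊u⌋₊ + 1} : Finset ℕ)) :
    hat n u = 0 := by
  simp only [Finset.mem_insert, Finset.mem_singleton, not_or] at hn
  have h1 := Nat.floor_le hu
  have h2 := Nat.lt_floor_add_one u
  refine max_eq_left ?_
  rcases lt_or_gt_of_ne hn.1 with h | h
  · have : (n : ℝ) + 1 ≤ ⌊u⌋₊ := by exact_mod_cast h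
    have := le_abs_self (u - n)
    linarith
  · have : ((⌊u⌋₊ : ℝ) + 1) + 1 ≤ n := by
      have : ⌊u⌋₊ + 1 + 1 ≤ n := by omega
      exact_mod_cast this
    have := neg_abs_le (u - n)
    linarith

theorem hasSum_hat {u : ℝ} (hu : 0 ≤ u) : HasSum (fun n => hat n u) 1 := by
  have h : HasSum (fun n => hat n u) (∑ n ∈ {⌊u⌋₊, ⌊u⌋₊ + 1}, hat n u) :=
    hasSum_sum_of_ne_finset_zero fun n hn => hat_eq_zero hu hn
  rwa [Finset.sum_pair (by simp), hat_floor hu, hat_floor_succ hu, sub_add_cancel] at h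

theorem exists_half_le_hat {u : ℝ} (hu : 0 ≤ u) : ∃ n, 1 / 2 ≤ hat n u := by
  rcases le_total (u - ⌊u⌋₊) (1 / 2) with h | h
  · exact ⟨⌊u⌋₊, by rw [hat_floor hu]; linarith⟩
  · exact ⟨⌊u⌋₊ + 1, by rw [hat_floor_succ hu]; exact h⟩

/-- Since `log` has derivative `1 / a`, a function of `log⁺ ‖x‖` changes along `x` at a rate
inversely proportional to `‖x‖`. -/
theorem mul_posLog_sub_posLog_le {a b : ℝ} (hb : 0 ≤ b) (hab : b ≤ a) :
    b * |Real.posLog a - Real.posLog b| ≤ a - b := by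
  have ha : 0 ≤ a := hb.trans hab
  have hA : (1 : ℝ) ≤ max 1 a := le_max_left _ _
  have hB : (1 : ℝ) ≤ max 1 b := le_max_left _ _
  have hmax : max 1 b ≤ max 1 a := max_le_max le_rfl hab
  rw [Real.posLog_eq_log_max_one ha, Real.posLog_eq_log_max_one hb,
    ← Real.log_div (by linarith) (by linarith),
    abs_of_nonneg (Real.log_nonneg ((one_le_div (by linarith)).2 hmax))]
  have h1 := Real.log_le_sub_one_of_pos (show 0 < max 1 a / max 1 b by positivity)
  have h2 : max 1 a - max 1 b ≤ a - b := by
    rcases max_cases 1 a with h | h <;> rcases max_cases 1 b with h' | h' <;> linarith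
  calc b * Real.log (max 1 a / max 1 b)
      ≤ max 1 b * (max 1 a / max 1 b - 1) :=
        mul_le_mul (le_max_right _ _) h1
          (Real.log_nonneg ((one_le_div (by linarith)).2 hmax)) (by linarith)
    _ = max 1 a - max 1 b := by field_simp
    _ ≤ a - b := h2

section

variable {𝕜 : Type*} [RCLike 𝕜] {p : ℝ≥0∞} [Fact (1 ≤ p)]
  {Y : Type*} [NormedAddCommGroup Y] [NormedSpace 𝕜 Y] [CompleteSpace Y]
  {X : Type*} [NormedAddCommGroup X]

/-- Gluing: maps `φ j` into `ℓ_p^{d j}`, where `j` encodes a pair `(n, k)`, are placed in the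
blocks of a decomposition with the weight `2 ^ (-(k + 1))` and a weight which restricts `φ j` to
the shell `‖x - t₀‖ ≈ exp (32 n)`. The weights of the shells vary so slowly that they hardly
increase the Lipschitz constant. -/
theorem exists_glued_map {d : ℕ → ℕ} {T : ∀ j, PiLp p (fun _ : Fin (d j) => 𝕜) →ₗ[𝕜] Y}
    (hT : ∀ j a, ‖a‖ ≤ ‖T j a‖ ∧ ‖T j a‖ ≤ 10 * ‖a‖)
    (hdec : ∀ (a : ∀ j, PiLp p (fun _ : Fin (d j) => 𝕜)) (y : Y),
      HasSum (fun j => T j (a j)) y → ∀ j, ‖T j (a j)‖ ≤ 2.2 * ‖y‖)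
    {M : Set X} {t₀ : X} {σ : ℕ → ℝ} {φ : ∀ j, X → PiLp p (fun _ : Fin (d j) => 𝕜)}
    (hφ : ∀ j x y, ‖φ j x - φ j y‖ ≤ ‖x - y‖) (hφ0 : ∀ j, φ j t₀ = 0)
    (hφM : ∀ n k : ℕ, ∀ x ∈ M, ∀ y ∈ M, ‖x - t₀‖ ≤ Real.exp (32 * (n + 1)) →
      ‖y - t₀‖ ≤ Real.exp (32 * (n + 1)) →
      ‖x - y‖ - σ k / 8 ≤ ‖φ (Nat.pair n k) x - φ (Nat.pair n k) y‖) :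
    ∃ F : X → Y, ∀ x ∈ M, ∀ y ∈ M, ‖F x - F y‖ ≤ 11.25 * ‖x - y‖ ∧
      ∀ k, σ k ≤ ‖x - y‖ → (1 / 2) ^ (k + 1) * (13 / 32) * ‖x - y‖ ≤ 2.2 * ‖F x - F y‖ := by
  classical
  set u : X → ℝ := fun x => Real.posLog ‖x - t₀‖ / 32 with hu_def
  have hu0 : ∀ x, 0 ≤ u x := fun x => div_nonneg Real.posLog_nonneg (by norm_num)
  set c : ℕ → X → ℝ := fun j x => hat (Nat.unpair j).1 (u x) * (1 / 2) ^ ((Nat.unpair j).2 + 1)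
    with hc_def
  have hc0 : ∀ j x, 0 ≤ c j x := fun j x => mul_nonneg (hat_nonneg _ _) (by positivity)
  have hφt : ∀ j x, ‖φ j x‖ ≤ ‖x - t₀‖ := fun j x => by
    have := hφ j x t₀
    rwa [hφ0, sub_zero] at this
  -- a weight which depends on `n` only, times `2 ^ (-(k + 1))`, is summed over all `j`
  have hsum : ∀ (w : ℕ → ℝ) (s : ℝ), (∀ n, 0 ≤ w n) → HasSum w s →
      HasSum (fun j => w (Nat.unpair j).1 * (1 / 2 : ℝ) ^ ((Nat.unpair j).2 + 1)) s := by
    intro w s hw hs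
    have hg : HasSum (fun k : ℕ => (1 / 2 : ℝ) ^ (k + 1)) 1 := by
      simpa [pow_succ, div_eq_mul_inv, mul_comm] using hasSum_geometric_two' 1
    have h1 : Summable fun x : ℕ × ℕ => w x.1 * (1 / 2 : ℝ) ^ (x.2 + 1) :=
      hs.summable.mul_of_nonneg hg.summable hw fun k => by positivity
    have h2 := hs.mul hg h1
    rw [mul_one] at h2
    exact (Nat.pairEquiv.symm.hasSum_iff (f := fun x : ℕ × ℕ => w x.1 * (1 / 2 : ℝ) ^ (x.2 + 1))).2
      h2
  set h : ∀ j, X → PiLp p (fun _ : Fin (d j) => 𝕜) := fun j x => (c j x : 𝕜) • φ j x with hh_def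
  have hsummable : ∀ x, Summable fun j => T j (h j x) := by
    intro x
    refine Summable.of_norm_bounded
      (((hsum _ 1 (fun n => hat_nonneg n (u x)) (hasSum_hat (hu0 x))).summable).mul_right
        (10 * ‖x - t₀‖)) fun j => ?_
    refine (hT j _).2.trans ?_
    rw [hh_def, norm_smul, RCLike.norm_ofReal, abs_of_nonneg (hc0 j x)]
    have := mul_le_mul_of_nonneg_left (hφt j x) (hc0 j x)
    simp only [hc_def] at this ⊢
    linarith
  set F : X → Y := fun x => ∑' j, T j (h j x) with hF_def
  have hFsub : ∀ x y, HasSum (fun j => T j (h j x - h j y)) (F x - F y) := by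
    intro x y
    simp only [map_sub]
    exact (hsummable x).hasSum.sub (hsummable y).hasSum
  -- by symmetry, `y` may be assumed closer to `t₀` than `x`
  suffices H : ∀ x ∈ M, ∀ y ∈ M, ‖y - t₀‖ ≤ ‖x - t₀‖ → ‖F x - F y‖ ≤ 11.25 * ‖x - y‖ ∧
      ∀ k, σ k ≤ ‖x - y‖ → (1 / 2) ^ (k + 1) * (13 / 32) * ‖x - y‖ ≤ 2.2 * ‖F x - F y‖ by
    refine ⟨F, fun x hx y hy => ?_⟩
    rcases le_total ‖y - t₀‖ ‖x - t₀‖ with hxy | hxy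
    · exact H x hx y hy hxy
    · have := H y hy x hx hxy
      rwa [norm_sub_rev y x, norm_sub_rev (F y) (F x)] at this
  intro x hx y hy hxy
  have hu : ‖y - t₀‖ * |u x - u y| ≤ ‖x - y‖ / 32 := by
    have h1 := mul_posLog_sub_posLog_le (norm_nonneg _) hxy
    have h2 := norm_sub_norm_le (x - t₀) (y - t₀)
    rw [sub_sub_sub_cancel_right] at h2
    simp only [hu_def]
    rw [← sub_div, abs_div, abs_of_pos (by norm_num : (0 : ℝ) < 32), ← mul_div_assoc]
    gcongr
    linarith
  have hcsub : ∀ j, |c j x - c j y| = |hat (Nat.unpair j).1 (u x) - hat (Nat.unpair j).1 (u y)| *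
      (1 / 2) ^ ((Nat.unpair j).2 + 1) := by
    intro j
    simp only [hc_def]
    rw [← sub_mul, abs_mul, abs_of_pos (show (0 : ℝ) < (1 / 2) ^ ((Nat.unpair j).2 + 1) by
      positivity)]
  have hsplit : ∀ j, h j x - h j y = (c j x : 𝕜) • (φ j x - φ j y) +
      ((c j x - c j y : ℝ) : 𝕜) • φ j y := by
    intro j
    simp only [hh_def]
    rw [RCLike.ofReal_sub, smul_sub, sub_smul]
    abel
  constructor
  · -- at most four shells are involved, which gives the constant `10 (1 + 4 / 32) = 11.25`
    set A : Finset ℕ := {⌊u x⌋₊, ⌊u x⌋₊ + 1} ∪ {⌊u y⌋₊, ⌊u y⌋₊ + 1} with hA_def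
    have hAcard : A.card ≤ 4 := by
      refine (Finset.card_union_le _ _).trans ?_
      have := Finset.card_le_two (a := ⌊u x⌋₊) (b := ⌊u x⌋₊ + 1)
      have := Finset.card_le_two (a := ⌊u y⌋₊) (b := ⌊u y⌋₊ + 1)
      omega
    have hAsum : HasSum (fun n => if n ∈ A then (1 / 32 : ℝ) else 0) (A.card / 32) := by
      have : HasSum (fun n => if n ∈ A then (1 / 32 : ℝ) else 0)
          (∑ n ∈ A, if n ∈ A then (1 / 32 : ℝ) else 0) :=
        hasSum_sum_of_ne_finset_zero fun n hn => if_neg hn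
      rw [Finset.sum_congr rfl fun n hn => if_pos hn, Finset.sum_const, nsmul_eq_mul] at this
      convert this using 1
      ring
    have hbound := (hsum _ _ (fun n => add_nonneg (hat_nonneg n (u x))
      (by split_ifs <;> norm_num)) ((hasSum_hat (hu0 x)).add hAsum)).mul_right (10 * ‖x - y‖)
    have hle := tsum_of_norm_bounded hbound (f := fun j => T j (h j x - h j y)) fun j => by
      refine (hT j _).2.trans ?_
      have h1 : ‖h j x - h j y‖ ≤ c j x * ‖x - y‖ + |c j x - c j y| * ‖y - t₀‖ := by
        rw [hsplit]
        refine (norm_add_le _ _).trans ?_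
        rw [norm_smul, norm_smul, RCLike.norm_ofReal, RCLike.norm_ofReal, abs_of_nonneg (hc0 j x)]
        gcongr
        · exact hc0 j x
        · exact hφ j x y
        · exact hφt j y
      have h2 : |hat (Nat.unpair j).1 (u x) - hat (Nat.unpair j).1 (u y)| * ‖y - t₀‖ ≤
          (if (Nat.unpair j).1 ∈ A then (1 / 32 : ℝ) else 0) * ‖x - y‖ := by
        split_ifs with hn
        · have := mul_le_mul_of_nonneg_left (abs_hat_sub_le (Nat.unpair j).1 (u x) (u y))
            (norm_nonneg (y - t₀))
          linarith
        · rw [hA_def, Finset.mem_union, not_or] at hn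
          rw [hat_eq_zero (hu0 x) hn.1, hat_eq_zero (hu0 y) hn.2]
          simp
      rw [hcsub] at h1
      have h3 := mul_le_mul_of_nonneg_left h2
        (show (0 : ℝ) ≤ (1 / 2) ^ ((Nat.unpair j).2 + 1) by positivity)
      simp only [hc_def] at h1
      linarith
    rw [(hFsub x y).tsum_eq] at hle
    have h4 : (A.card : ℝ) ≤ 4 := by exact_mod_cast hAcard
    nlinarith [norm_nonneg (x - y)]
  · -- one block suffices, in a shell whose weight at `x` is at least `1/2`; the constant is
    -- `13 / 32 = 1/2 * 7/8 - 1/32`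
    intro k hk
    obtain ⟨n, hn⟩ := exists_half_le_hat (hu0 x)
    have hball : ‖x - t₀‖ ≤ Real.exp (32 * (n + 1)) := by
      have h1 : u x < n + 1 := by
        by_contra! hcon
        have : hat n (u x) = 0 := max_eq_left (by
          have := le_abs_self (u x - n)
          linarith)
        linarith
      have h2 : Real.log ‖x - t₀‖ ≤ 32 * (n + 1) := by
        have h3 : Real.log ‖x - t₀‖ ≤ Real.posLog ‖x - t₀‖ := le_max_right _ _
        simp only [hu_def] at h1
        rw [div_lt_iff₀ (by norm_num)] at h1
        linarith
      rcases (norm_nonneg (x - t₀)).eq_or_lt with h0 | h0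
      · rw [← h0]; positivity
      · exact (Real.log_le_iff_le_exp h0).1 h2
    have h1 := hφM n k x hx y hy hball (hxy.trans hball)
    have h2 := hdec (fun j => h j x - h j y) _ (hFsub x y) (Nat.pair n k)
    refine le_trans ?_ ((hT _ _).1.trans h2)
    set j := Nat.pair n k with hj
    have hjn : (Nat.unpair j).1 = n := by rw [hj, Nat.unpair_pair]
    have hjk : (Nat.unpair j).2 = k := by rw [hj, Nat.unpair_pair]
    have h3 : c j x * ‖φ j x - φ j y‖ - |c j x - c j y| * ‖φ j y‖ ≤ ‖h j x - h j y‖ := by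
      rw [hsplit]
      have := norm_sub_le_norm_add ((c j x : 𝕜) • (φ j x - φ j y))
        (((c j x - c j y : ℝ) : 𝕜) • φ j y)
      rwa [norm_smul, norm_smul, RCLike.norm_ofReal, RCLike.norm_ofReal,
        abs_of_nonneg (hc0 j x)] at this
    refine le_trans ?_ h3
    rw [hcsub, hjn, hjk]
    have h4 : 1 / 2 * (1 / 2) ^ (k + 1) ≤ c j x := by
      simp only [hc_def, hjn, hjk]
      gcongr
    have h5 : |hat n (u x) - hat n (u y)| * ‖φ j y‖ ≤ ‖x - y‖ / 32 := by
      have := mul_le_mul (abs_hat_sub_le n (u x) (u y)) (hφt j y) (norm_nonneg _) (abs_nonneg _)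
      linarith
    have h6 : 7 / 8 * ‖x - y‖ ≤ ‖φ j x - φ j y‖ := by linarith
    have hpow : (0 : ℝ) < (1 / 2) ^ (k + 1) := by positivity
    have h7 := mul_le_mul h4 h6 (by positivity) (hc0 j x)
    have h8 := mul_le_mul_of_nonneg_left h5 hpow.le
    linarith

end

theorem mainTheorem1 {𝕜 : Type*} [RCLike 𝕜] (p : ℝ≥0∞) [Fact (1 ≤ p)]
    {Ω : Type*} [MeasurableSpace Ω] (ν : Measure Ω)
    {Y : Type*} [NormedAddCommGroup Y] [NormedSpace 𝕜 Y] [CompleteSpace Y]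
    (hY : ContainsEllpUniformly 𝕜 p Y)
    (M : Set (Lp 𝕜 p ν)) (hM : ProperSpace M)
    (r : ℝ) (hr : r < 1 / 16)
    (μ : ℝ → ℝ) (hμ_cont : ContinuousOn μ (Set.Ioi 0)) (hμ_mono : MonotoneOn μ (Set.Ioi 0))
    (hμ_maps : Set.MapsTo μ (Set.Ioi 0) (Set.Iio 0))
    (hμ_surj : Set.SurjOn μ (Set.Ioi 0) (Set.Iio 0)) :
    ∃ f : M → Y, ∀ x y : M,
      (2 : ℝ) ^ μ ‖(x : Lp 𝕜 p ν) - (y : Lp 𝕜 p ν)‖ * r * ‖(x : Lp 𝕜 p ν) - (y : Lp 𝕜 p ν)‖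
          ≤ ‖f x - f y‖ ∧
        ‖f x - f y‖ ≤ 9 * ‖(x : Lp 𝕜 p ν) - (y : Lp 𝕜 p ν)‖ := by
  rcases M.eq_empty_or_nonempty with rfl | ⟨t₀, ht₀⟩
  · exact ⟨fun _ => 0, fun x => x.2.elim⟩
  -- the scale `σ k` at which the `k`-th approximation of a shell has to be accurate
  have hσ : ∀ k : ℕ, ∃ s : ℝ, 0 < s ∧ μ s = -((k : ℝ) + 2) := fun k =>
    hμ_surj (show -((k : ℝ) + 2) ∈ Set.Iio (0 : ℝ) by
      have : (0 : ℝ) ≤ k := k.cast_nonneg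
      simp only [Set.mem_Iio]
      linarith)
  choose σ hσ0 hσμ using hσ
  have hK : ∀ n : ℕ, IsCompact ((fun x : M => (x : Lp 𝕜 p ν)) ''
      Metric.closedBall ⟨t₀, ht₀⟩ (Real.exp (32 * ((n : ℝ) + 1)))) := fun n =>
    (isCompact_closedBall _ _).image continuous_subtype_val
  choose d φ hφ hφ0 hφK using fun n k =>
    exists_lipschitz_approx (hK n) (show 0 < σ k / 8 by linarith [hσ0 k]) t₀
  obtain ⟨T, hT, hdec⟩ := hY.hasCopies.exists_decomposition
    fun j => d (Nat.unpair j).1 (Nat.unpair j).2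
  obtain ⟨F, hF⟩ := exists_glued_map hT hdec (M := M) (t₀ := t₀) (σ := σ)
    (φ := fun j => φ (Nat.unpair j).1 (Nat.unpair j).2) (fun j => hφ _ _) (fun j => hφ0 _ _) (by
      intro n k x hx y hy hxn hyn
      have h1 : (Nat.unpair (Nat.pair n k)).1 = n := by rw [Nat.unpair_pair]
      have h2 : (Nat.unpair (Nat.pair n k)).2 = k := by rw [Nat.unpair_pair]
      have hmem : ∀ z ∈ M, ‖z - t₀‖ ≤ Real.exp (32 * ((n : ℝ) + 1)) →
          z ∈ (fun x : M => (x : Lp 𝕜 p ν)) ''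
            Metric.closedBall ⟨t₀, ht₀⟩ (Real.exp (32 * ((n : ℝ) + 1))) := fun z hz hzn =>
        ⟨⟨z, hz⟩, by rwa [Metric.mem_closedBall, Subtype.dist_eq, dist_eq_norm], rfl⟩
      have := hφK n k x (hmem x hx hxn) y (hmem y hy hyn)
      rw [h1, h2]
      exact this)
  -- the factor `0.8` turns the Lipschitz constant `11.25` into `9`
  refine ⟨fun x => ((0.8 : ℝ) : 𝕜) • F x, fun x y => ?_⟩
  obtain ⟨hup, hlow⟩ := hF x x.2 y y.2
  rw [← smul_sub, norm_smul, RCLike.norm_ofReal, abs_of_pos (by norm_num)]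
  refine ⟨?_, by linarith⟩
  set t := ‖(x : Lp 𝕜 p ν) - (y : Lp 𝕜 p ν)‖ with ht
  rcases (norm_nonneg ((x : Lp 𝕜 p ν) - (y : Lp 𝕜 p ν))).eq_or_lt with h0 | h0
  · rw [← ht] at h0
    rw [← h0, mul_zero]
    positivity
  rw [← ht] at h0
  have hμt : μ t < 0 := hμ_maps h0
  obtain ⟨k, hk⟩ : ∃ k : ℕ, ⌈-μ t⌉₊ = k + 1 :=
    Nat.exists_eq_succ_of_ne_zero (Nat.ceil_pos.2 (by linarith)).ne'
  have hk1 : -μ t ≤ k + 1 := by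
    have := Nat.le_ceil (-μ t)
    rw [hk] at this
    exact_mod_cast this
  have hk2 : (k : ℝ) < -μ t := by
    rw [← Nat.lt_ceil, hk]
    exact Nat.lt_succ_self k
  have hσt : σ k ≤ t := by
    by_contra! hcon
    have := hμ_mono h0 (hσ0 k) hcon.le
    rw [hσμ] at this
    linarith
  have h1 := hlow k hσt
  have h2 : (2 : ℝ) ^ μ t ≤ 2 * (1 / 2) ^ (k + 1) := by
    calc (2 : ℝ) ^ μ t ≤ (2 : ℝ) ^ (-(k : ℝ)) :=
          Real.rpow_le_rpow_of_exponent_le one_le_two (by linarith)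
      _ = 2 * (1 / 2) ^ (k + 1) := by
          rw [Real.rpow_neg zero_le_two, Real.rpow_natCast, pow_succ, one_div, inv_pow]
          ring
  have h3 : (2 : ℝ) ^ μ t * r * t ≤ 2 * (1 / 2) ^ (k + 1) * (1 / 16) * t := by
    have e1 : (2 : ℝ) ^ μ t * r ≤ (2 : ℝ) ^ μ t * (1 / 16) := by gcongr
    have e2 : (2 : ℝ) ^ μ t * (1 / 16) ≤ 2 * (1 / 2) ^ (k + 1) * (1 / 16) := by gcongr
    exact mul_le_mul_of_nonneg_right (e1.trans e2) h0.le
  have h4 : 0 ≤ (1 / 2 : ℝ) ^ (k + 1) * t := by positivity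
  linarith
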